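/- **Setting.** A *causal operational-probabilistic theory* consists of systems and transformations forming a symmetric monoidal category (unit $\mathrm I$, product $\otimes$); states of $\mathrm A$ are transformations $\mathrm I\to\mathrm A$, effects are transformations $\mathrm A\to\mathrm I$. Every circuit without external wires has a probability, transformations with the same probabilities in all circuits are identified, and sums of transformations are taken in the real vector space spanned by their probability vectors. Certain finite collections $\{\mathcal C_i\}_{i\in X}$ of transformations $\mathrm A\to\mathrm B$ are *tests*; every transformation belongs to a test, the outcome probabilities of a test $\mathrm I\to\mathrm I$ sum to one, tests are closed under sequential composition (the later test may depend on earlier outcomes), parallel composition and coarse-graining (joining outcomes), and the identities and structural isomorphisms (including the swaps) are one-outcome tests. A *channel* is a transformation forming a one-outcome test; it is *reversible* if it has an inverse channel. A transformation $\mathcal C$ is *pure* if, whenever a collection $\{\mathcal D_j\}$ of outcomes of a test is coarse-grained to $\mathcal C$, one has $\mathcal D_j=p_j\mathcal C$ for a probability distribution $\{p_j\}$. As part of the framework: every system has exactly one deterministic effect $\mathrm{Tr}$ (causality); every test has a refinement consisting of pure transformations; and, for each system, the measurements (tests $\mathrm A\to\mathrm I$) with a given outcome set are closed under pointwise limits of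 their outcome probabilities on states. Marginals of bipartite states are obtained by applying $\mathrm{Tr}$ to the other system. Assume that the theory satisfies * *Purification*: every state $\rho$ of any system $\mathrm A$ is the marginal on $\mathrm A$ of a pure state of $\mathrm A\otimes\mathrm B$ for some $\mathrm B$; and any two pure states $\Psi,\Psi'$ of $\mathrm A\otimes\mathrm B$ with the same marginal on $\mathrm A$ satisfy $\Psi'=(\mathcal I_{\mathrm A}\otimes\mathcal U)\Psi$ for some reversible channel $\mathcal U$ on $\mathrm B$; * *Purity Preservation*: if $\mathcal A:\mathrm A\to\mathrm A'\otimes\mathrm C$ and $\mathcal B:\mathrm C\otimes\mathrm B\to\mathrm B'$ are pure, then so is $(\mathcal I_{\mathrm A'}\otimes\mathcal B)(\mathcal A\otimes\mathcal I_{\mathrm B}):\mathrm A\otimes\mathrm B\to\mathrm A'\otimes\mathrm B'$; * *Local Exchangeability*: for every pure state $\Psi$ of $\mathrm A\otimes\mathrm B$ there are channels $\mathcal C:\mathrm A\to\mathrm B$ and $\mathcal D:\mathrm B\to\mathrm A$ with $(\mathcal C\otimes\mathcal D)\Psi=\mathtt{SWAP}\,\Psi$. An *LOCC channel* is the coarse-graining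 over all outcomes of a finite sequence of tests performed by Alice on the first system or by Bob on the second system, where each test may depend on all previous outcomes of both parties. A *random reversible (RaRe) channel* on $\mathrm A$ is a channel of the form $\sum_i p_i\,\mathcal U^{(i)}$, with finitely many reversible channels $\mathcal U^{(i)}$ on $\mathrm A$ and a probability distribution $\{p_i\}$ allowed by the theory (the outcome distribution of a test $\mathrm I\to\mathrm I$). **Theorem (Entanglement-thermodynamics duality).** Let $\Psi$ and $\Psi'$ be two pure states of $\mathrm A\otimes\mathrm B$, and let $\rho,\rho'$ and $\sigma,\sigma'$ be their marginals on $\mathrm A$ and $\mathrm B$, respectively. The following are equivalent: 1. $\Psi$ is more entangled than $\Psi'$, i.e. $\Psi'=\mathcal L\Psi$ for some LOCC channel $\mathcal L$; 2. $\rho$ is more mixed than $\rho'$, i.e. $\rho=\mathcal R\rho'$ for some RaRe channel $\mathcal R$ on $\mathrm A$; 3. $\sigma$ is more mixed than $\sigma'$, i.e. $\sigma=\mathcal R\sigma'$ for some RaRe channel $\mathcal R$ on $\mathrm B$. -/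

import Mathlib

open CategoryTheory MonoidalCategory

universe v u

namespace Operational

section Circuits

variable {C : Type u} [Category.{v} C] [MonoidalCategory C] [SymmetricCategory C]

/-- A circuit without external wires and with one open slot of type `A ⟶ B`: an ancilla `R`, an
input state of `A ⊗ R` and an output effect on `B ⊗ R`. -/
structure Context (A B : C) where
  /-- the ancilla -/
  R : C
  /-- the input state -/
  input : 𝟙_ C ⟶ A ⊗ R
  /-- the output effect -/
  output : B ⊗ R ⟶ 𝟙_ C

/-- The probabilities of the transformation `f` in all circuits. Sums and real multiples of
transformations are taken in the real vector space `Context A B → ℝ` of these vectors. -/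
def stat (prob : (𝟙_ C ⟶ 𝟙_ C) → ℝ) {A B : C} (f : A ⟶ B) : Context A B → ℝ :=
  fun c => prob (c.input ≫ f ▷ c.R ≫ c.output)

open Classical in
/-- The collection `f` is obtained from the collection `g` by joining outcomes: `π` splits the
outcomes of `g` into (nonempty) blocks labelled by the outcomes of `f`, and every `f i` is the sum
of its block. -/
def IsCoarseGraining (prob : (𝟙_ C ⟶ 𝟙_ C) → ℝ) {A B : C} {X Y : Type} [Fintype X] [Fintype Y]
    (f : X → (A ⟶ B)) (g : Y → (A ⟶ B)) (π : Y → X) : Prop :=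
  Function.Surjective π ∧
    ∀ i, stat prob (f i) = ∑ j ∈ Finset.univ.filter (fun j => π j = i), stat prob (g j)

end Circuits

/-- An operational-probabilistic theory. Systems are the objects of a symmetric monoidal category
`C`, transformations are its morphisms, states of `A` are the morphisms `𝟙_ C ⟶ A` and effects on
`A` are the morphisms `A ⟶ 𝟙_ C`. Tests have finitely many outcomes. -/
structure OPT (C : Type u) [Category.{v} C] [MonoidalCategory C] [SymmetricCategory C] where
  /-- the probability of a circuit without external wires -/
  prob : (𝟙_ C ⟶ 𝟙_ C) → ℝ
  prob_nonneg : ∀ s, 0 ≤ prob s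
  prob_comp : ∀ s t : 𝟙_ C ⟶ 𝟙_ C, prob (s ≫ t) = prob s * prob t
  /-- transformations with the same probabilities in all circuits are identified -/
  stat_injective : ∀ {A B : C} (f g : A ⟶ B), stat prob f = stat prob g → f = g
  /-- the finite collections of transformations that are tests -/
  IsTest : ∀ {A B : C} {X : Type} [Fintype X], (X → (A ⟶ B)) → Prop
  /-- the outcome probabilities of a test without external wires sum to one -/
  prob_sum : ∀ {X : Type} [Fintype X] (s : X → (𝟙_ C ⟶ 𝟙_ C)), IsTest s → ∑ i, prob (s i) = 1
  /-- every transformation occurs in a test -/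
  exists_test : ∀ {A B : C} (f : A ⟶ B),
    ∃ (X : Type) (_ : Fintype X) (t : X → (A ⟶ B)) (i : X), IsTest t ∧ t i = f
  test_id : ∀ A : C, IsTest (fun _ : Unit => 𝟙 A)
  test_swap : ∀ A B : C, IsTest (fun _ : Unit => (β_ A B).hom)
  test_associator : ∀ A B D : C, IsTest (fun _ : Unit => (α_ A B D).hom)
  test_associator_inv : ∀ A B D : C, IsTest (fun _ : Unit => (α_ A B D).inv)
  test_leftUnitor : ∀ A : C, IsTest (fun _ : Unit => (λ_ A).hom)
  test_leftUnitor_inv : ∀ A : C, IsTest (fun _ : Unit => (λ_ A).inv)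
  test_rightUnitor : ∀ A : C, IsTest (fun _ : Unit => (ρ_ A).hom)
  test_rightUnitor_inv : ∀ A : C, IsTest (fun _ : Unit => (ρ_ A).inv)
  /-- sequential composition of tests -/
  test_comp : ∀ {A B D : C} {X Y : Type} [Fintype X] [Fintype Y]
    (f : X → (A ⟶ B)) (g : Y → (B ⟶ D)), IsTest f → IsTest g →
    IsTest (fun k : X × Y => f k.1 ≫ g k.2)
  /-- parallel composition of tests -/
  test_tensor : ∀ {A A' B B' : C} {X Y : Type} [Fintype X] [Fintype Y]
    (f : X → (A ⟶ A')) (g : Y → (B ⟶ B')), IsTest f → IsTest g →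
    IsTest (fun k : X × Y => f k.1 ⊗ₘ g k.2)
  /-- outcomes of a test can be joined -/
  coarse_grain : ∀ {A B : C} {X Y : Type} [Fintype X] [Fintype Y] (g : Y → (A ⟶ B)) (π : Y → X),
    IsTest g → Function.Surjective π →
    ∃ f : X → (A ⟶ B), IsTest f ∧ IsCoarseGraining prob f g π
  /-- measurements are closed under limits: a pointwise limit of the outcome probabilities (as
  functions of the state) of measurements on `A` is again given by a measurement on `A` -/
  measurements_closed : ∀ (A : C) (X : Type) [Fintype X],
    IsClosed {P : X → (𝟙_ C ⟶ A) → ℝ |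
      ∃ a : X → (A ⟶ 𝟙_ C), IsTest a ∧ ∀ i ω, P i ω = prob (ω ≫ a i)}

namespace OPT

variable {C : Type u} [Category.{v} C] [MonoidalCategory C] [SymmetricCategory C] (T : OPT C)

/-- A deterministic transformation: one that forms a test with a single outcome. -/
def IsChannel {A B : C} (f : A ⟶ B) : Prop :=
  T.IsTest (fun _ : Unit => f)

/-- A channel with an inverse channel. -/
def IsReversible {A B : C} (f : A ⟶ B) : Prop :=
  T.IsChannel f ∧ ∃ g : B ⟶ A, T.IsChannel g ∧ f ≫ g = 𝟙 A ∧ g ≫ f = 𝟙 B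

open Classical in
/-- A transformation is pure if it has only trivial refinements: whenever a test `d` refines a test
`c` and `f` is the transformation of `c` at the outcome `i`, the transformations of `d` in the
block of `i` are multiples of `f` by a probability distribution. -/
def IsPure {A B : C} (f : A ⟶ B) : Prop :=
  ∀ (X Y : Type) [Fintype X] [Fintype Y] (c : X → (A ⟶ B)) (d : Y → (A ⟶ B)) (π : Y → X),
    T.IsTest c → T.IsTest d → IsCoarseGraining T.prob c d π → ∀ i : X, c i = f →
    ∃ p : Y → ℝ, (∀ j, 0 ≤ p j) ∧ ∑ j ∈ Finset.univ.filter (fun j => π j = i), p j = 1 ∧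
      ∀ j, π j = i → stat T.prob (d j) = p j • stat T.prob f

end OPT

/-- A causal theory: every system has exactly one deterministic effect, and tests may be chosen
according to the outcomes of previous tests. Every test is assumed to have a refinement that
consists of pure transformations. -/
structure CausalOPT (C : Type u) [Category.{v} C] [MonoidalCategory C] [SymmetricCategory C]
    extends OPT C where
  /-- the deterministic effect, which discards the system -/
  discard : ∀ A : C, A ⟶ 𝟙_ C
  discard_channel : ∀ A : C, toOPT.IsChannel (discard A)
  discard_unique : ∀ (A : C) (e : A ⟶ 𝟙_ C), toOPT.IsChannel e → e = discard A
  test_conditional : ∀ {A B D : C} {X : Type} [Fintype X] {Y : X → Type} [∀ i, Fintype (Y i)]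
    (f : X → (A ⟶ B)) (g : ∀ i, Y i → (B ⟶ D)), IsTest f → (∀ i, IsTest (g i)) →
    IsTest (fun k : (i : X) × Y i => f k.1 ≫ g k.1 k.2)
  pure_decomposition : ∀ {A B : C} {X : Type} [Fintype X] (f : X → (A ⟶ B)), IsTest f →
    ∃ (Y : Type) (_ : Fintype Y) (g : Y → (A ⟶ B)) (π : Y → X),
      IsTest g ∧ IsCoarseGraining prob f g π ∧ ∀ j, toOPT.IsPure (g j)

namespace CausalOPT

variable {C : Type u} [Category.{v} C] [MonoidalCategory C] [SymmetricCategory C]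
  (T : CausalOPT C)

/-- The marginal on `A` of a state of `A ⊗ B`. -/
def marginalLeft {A B : C} (ω : 𝟙_ C ⟶ A ⊗ B) : 𝟙_ C ⟶ A :=
  ω ≫ A ◁ T.discard B ≫ (ρ_ A).hom

/-- The marginal on `B` of a state of `A ⊗ B`. -/
def marginalRight {A B : C} (ω : 𝟙_ C ⟶ A ⊗ B) : 𝟙_ C ⟶ B :=
  ω ≫ T.discard A ▷ B ≫ (λ_ B).hom

/-- Purity Preservation: connecting the output `D` of a pure transformation `A ⟶ A' ⊗ D` to the
input `D` of a pure transformation `D ⊗ B ⟶ B'` gives a pure transformation. -/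
def PurityPreservation : Prop :=
  ∀ {A A' B B' D : C} (f : A ⟶ A' ⊗ D) (g : D ⊗ B ⟶ B'), T.IsPure f → T.IsPure g →
    T.IsPure (f ▷ B ≫ (α_ A' D B).hom ≫ A' ◁ g)

/-- Local Exchangeability: on every pure bipartite state, the swap can be realized by a pair of
local channels. -/
def LocalExchangeability : Prop :=
  ∀ {A B : C} (Ψ : 𝟙_ C ⟶ A ⊗ B), T.IsPure Ψ →
    ∃ (c : A ⟶ B) (d : B ⟶ A), T.IsChannel c ∧ T.IsChannel d ∧
      Ψ ≫ (c ⊗ₘ d) = Ψ ≫ (β_ A B).hom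

/-- Purification: every state is a marginal of a pure state, and two purifications of the same
state with the same purifying system differ by a reversible channel on the purifying system. -/
def Purification : Prop :=
  (∀ {A : C} (ω : 𝟙_ C ⟶ A), ∃ (B : C) (Ψ : 𝟙_ C ⟶ A ⊗ B), T.IsPure Ψ ∧ T.marginalLeft Ψ = ω) ∧
  (∀ {A B : C} (Ψ Ψ' : 𝟙_ C ⟶ A ⊗ B), T.IsPure Ψ → T.IsPure Ψ' →
    T.marginalLeft Ψ = T.marginalLeft Ψ' →
    ∃ U : B ⟶ B, T.IsReversible U ∧ Ψ' = Ψ ≫ A ◁ U)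

/-- A random reversible channel: a mixture of reversible channels on `A`, with a probability
distribution that is allowed by the theory, i.e. is the outcome distribution of a test without
external wires. -/
def IsRandomReversible {A : C} (R : A ⟶ A) : Prop :=
  T.IsChannel R ∧ ∃ (X : Type) (_ : Fintype X) (p : X → (𝟙_ C ⟶ 𝟙_ C)) (U : X → (A ⟶ A)),
    T.IsTest p ∧ (∀ i, T.IsReversible (U i)) ∧
      stat T.prob R = ∑ i, T.prob (p i) • stat T.prob (U i)

/-- `ω` is more mixed than `ω'`: it can be obtained from `ω'` by a random reversible channel. -/
def MoreMixed {A : C} (ω ω' : 𝟙_ C ⟶ A) : Prop :=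
  ∃ R : A ⟶ A, T.IsRandomReversible R ∧ ω' ≫ R = ω

/-- LOCC protocols from `A ⊗ B` to `A' ⊗ B'`: finite sequences of tests performed by Alice (who
holds the first system) or by Bob (who holds the second one), where the continuation of the
protocol may depend on all outcomes so far. -/
inductive LOCC : C → C → C → C → Type (max 1 u v)
  /-- the protocol stops -/
  | done (A B : C) : LOCC A B A B
  /-- Alice performs the test `f` and announces the outcome -/
  | alice {A A₁ B A' B' : C} {X : Type} [Fintype X] (f : X → (A ⟶ A₁)) (hf : T.IsTest f)
      (next : X → LOCC A₁ B A' B') : LOCC A B A' B'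
  /-- Bob performs the test `g` and announces the outcome -/
  | bob {A B B₁ A' B' : C} {X : Type} [Fintype X] (g : X → (B ⟶ B₁)) (hg : T.IsTest g)
      (next : X → LOCC A B₁ A' B') : LOCC A B A' B'

namespace LOCC

variable {T}

/-- The sequences of outcomes of a protocol. -/
def Outcome : {A B A' B' : C} → LOCC T A B A' B' → Type
  | _, _, _, _, done _ _ => Unit
  | _, _, _, _, alice (X := X) _ _ next => (i : X) × Outcome (next i)
  | _, _, _, _, bob (X := X) _ _ next => (i : X) × Outcome (next i)

/-- There are finitely many sequences of outcomes. -/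
@[reducible] def fintypeOutcome : {A B A' B' : C} → (t : LOCC T A B A' B') → Fintype t.Outcome
  | _, _, _, _, done _ _ => inferInstanceAs (Fintype Unit)
  | _, _, _, _, alice (X := X) _ _ next =>
      letI : ∀ i, Fintype (next i).Outcome := fun i => fintypeOutcome (next i)
      inferInstanceAs (Fintype ((i : X) × (next i).Outcome))
  | _, _, _, _, bob (X := X) _ _ next =>
      letI : ∀ i, Fintype (next i).Outcome := fun i => fintypeOutcome (next i)
      inferInstanceAs (Fintype ((i : X) × (next i).Outcome))

instance {A B A' B' : C} (t : LOCC T A B A' B') : Fintype t.Outcome := fintypeOutcome t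

/-- The composite of Alice's transformations for a given sequence of outcomes. -/
def onAlice : {A B A' B' : C} → (t : LOCC T A B A' B') → t.Outcome → (A ⟶ A')
  | _, _, _, _, done A _, _ => 𝟙 A
  | _, _, _, _, alice f _ next, k => f k.1 ≫ onAlice (next k.1) k.2
  | _, _, _, _, bob _ _ next, k => onAlice (next k.1) k.2

/-- The composite of Bob's transformations for a given sequence of outcomes. -/
def onBob : {A B A' B' : C} → (t : LOCC T A B A' B') → t.Outcome → (B ⟶ B')
  | _, _, _, _, done _ B, _ => 𝟙 B
  | _, _, _, _, alice _ _ next, k => onBob (next k.1) k.2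
  | _, _, _, _, bob g _ next, k => g k.1 ≫ onBob (next k.1) k.2

end LOCC

/-- A channel that is obtained from an LOCC protocol by joining all sequences of outcomes. -/
def IsLOCCChannel {A B A' B' : C} (L : A ⊗ B ⟶ A' ⊗ B') : Prop :=
  ∃ t : LOCC T A B A' B', stat T.prob L = ∑ k, stat T.prob (t.onAlice k ⊗ₘ t.onBob k)

/-- `ω` is more entangled than `ω'`: an LOCC channel transforms `ω` into `ω'`. -/
def MoreEntangled {A B A' B' : C} (ω : 𝟙_ C ⟶ A ⊗ B) (ω' : 𝟙_ C ⟶ A' ⊗ B') : Prop :=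
  ∃ L : A ⊗ B ⟶ A' ⊗ B', T.IsLOCCChannel L ∧ ω ≫ L = ω'

end CausalOPT

end Operational

set_option linter.unusedSectionVars false

/-! On a pure state, local exchangeability lets Alice simulate Bob. Swap the state by local
channels, apply Bob's pure transformation on her side, and swap back by local channels
(`exists_transfer`). After all tests are refined to pure ones, which keeps every intermediate state
pure, an LOCC protocol on `Ψ` becomes one test by Alice followed by channels of Bob
(`LOCC.exists_oneWay`). The direction of communication can also be reversed (`OneWay.braiding`).

From entanglement to mixedness (`OneWay.moreMixed`): since `Ψ'` is pure, each branch of the one-way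
protocol is `p j` times `Ψ'`. Before Bob's channel, the branch is a pure state with the same
marginal on `A`, so it differs from `p j` times `Ψ'` by a reversible `U j` on `B`. Discarding `A`
and summing exhibits the marginal of `Ψ` on `B` as a random reversible image of that of `Ψ'`. The
weights are an allowed distribution by `exists_conditioned`.

From mixedness to entanglement (`MoreMixed.oneWay_braiding`): if `ρ` is the mixture of the `U i`
applied to `ρ'`, purify the mixture of the states `(U i ⊗ 1) Ψ'`. Bob can produce this purification
from `Ψ` by a channel (`Purification.exists_channel`). A measurement of the purifying system then
steers to the branches (`exists_steering`), and Alice undoes `U i`.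

Steering ordinarily uses perfectly distinguishable flag states, which are not assumed here. If `Ψ ≠
Ψ'`, some two states are distinguishable with a bias. Repetition makes any finite number of flags
almost distinguishable, and closedness of the measurements removes the error. -/

namespace Operational

/-! ### Linearity of circuit operations on probability vectors -/

section Stat

variable {C : Type u} [Category.{v} C] [MonoidalCategory C] [SymmetricCategory C]

/-- An operation on transformations that amounts to inserting the transformation into a larger
circuit. Such operations are linear on the vectors of probabilities. -/
def PullsBack (prob : (𝟙_ C ⟶ 𝟙_ C) → ℝ) {A B A' B' : C} (F : (A ⟶ B) → (A' ⟶ B')) : Prop :=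
  ∃ φ : Context A' B' → Context A B, ∀ f c, stat prob (F f) c = stat prob f (φ c)

namespace PullsBack

variable {prob : (𝟙_ C ⟶ 𝟙_ C) → ℝ} {A B A' B' : C} {F : (A ⟶ B) → (A' ⟶ B')}

theorem id : PullsBack prob (fun f : A ⟶ B => f) := ⟨fun c => c, fun _ _ => rfl⟩

theorem precomp (hF : PullsBack prob F) {D : C} (h : D ⟶ A') :
    PullsBack prob (fun f => h ≫ F f) := by
  obtain ⟨φ, hφ⟩ := hF
  refine ⟨fun c => φ ⟨c.R, c.input ≫ h ▷ c.R, c.output⟩, fun f c => ?_⟩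
  rw [← hφ]
  simp [stat]

theorem postcomp (hF : PullsBack prob F) {D : C} (k : B' ⟶ D) :
    PullsBack prob (fun f => F f ≫ k) := by
  obtain ⟨φ, hφ⟩ := hF
  refine ⟨fun c => φ ⟨c.R, c.input, k ▷ c.R ≫ c.output⟩, fun f c => ?_⟩
  rw [← hφ]
  simp [stat]

theorem whiskerRight (hF : PullsBack prob F) (S : C) : PullsBack prob (fun f => F f ▷ S) := by
  obtain ⟨φ, hφ⟩ := hF
  refine ⟨fun c => φ ⟨S ⊗ c.R, c.input ≫ (α_ _ _ _).hom, (α_ _ _ _).inv ≫ c.output⟩,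
    fun f c => ?_⟩
  rw [← hφ]
  simp [stat]

/-- Contexts carry their ancilla on the right only, so the left-hand case is obtained by conjugating
with the braiding. -/
theorem whiskerLeft (hF : PullsBack prob F) (S : C) : PullsBack prob (fun f => S ◁ F f) := by
  have h := ((hF.whiskerRight S).postcomp (β_ B' S).hom).precomp (β_ S A').hom
  have e : (fun f => S ◁ F f) = fun f => (β_ S A').hom ≫ F f ▷ S ≫ (β_ B' S).hom := by
    funext f
    rw [BraidedCategory.braiding_naturality_left, SymmetricCategory.symmetry_assoc]
  rw [e]; exact h

theorem tensorRight (hF : PullsBack prob F) {S S' : C} (g : S ⟶ S') :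
    PullsBack prob (fun f => F f ⊗ₘ g) := by
  simp only [MonoidalCategory.tensorHom_def]
  exact (hF.whiskerRight S).postcomp _

theorem tensorLeft (hF : PullsBack prob F) {S S' : C} (g : S ⟶ S') :
    PullsBack prob (fun f => g ⊗ₘ F f) := by
  simp only [MonoidalCategory.tensorHom_def]
  exact (hF.whiskerLeft S').precomp _

theorem stat_sum (hF : PullsBack prob F) {J : Type*} {s : Finset J} {f : A ⟶ B} {g : J → (A ⟶ B)}
    (h : stat prob f = ∑ j ∈ s, stat prob (g j)) :
    stat prob (F f) = ∑ j ∈ s, stat prob (F (g j)) := by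
  obtain ⟨φ, hφ⟩ := hF
  funext c
  simp [hφ, h]

theorem stat_smul (hF : PullsBack prob F) {f g : A ⟶ B} {r : ℝ}
    (h : stat prob f = r • stat prob g) : stat prob (F f) = r • stat prob (F g) := by
  obtain ⟨φ, hφ⟩ := hF
  funext c
  simp [hφ, h]

end PullsBack

theorem IsCoarseGraining.map {prob : (𝟙_ C ⟶ 𝟙_ C) → ℝ} {A B A' B' : C}
    {F : (A ⟶ B) → (A' ⟶ B')} (hF : PullsBack prob F) {X Y : Type} [Fintype X] [Fintype Y]
    {f : X → (A ⟶ B)} {g : Y → (A ⟶ B)} {π : Y → X} (h : IsCoarseGraining prob f g π) :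
    IsCoarseGraining prob (fun i => F (f i)) (fun j => F (g j)) π :=
  ⟨h.1, fun i => hF.stat_sum (h.2 i)⟩

/-- An additive quantity can be summed over the outcomes of a refinement. -/
theorem IsCoarseGraining.sum_map {prob : (𝟙_ C ⟶ 𝟙_ C) → ℝ} {A B : C} {M : Type*}
    [AddCommMonoid M] {X Y : Type} [Fintype X] [Fintype Y] (G : X → (A ⟶ B) → M)
    {f : X → (A ⟶ B)} {g : Y → (A ⟶ B)} {π : Y → X}
    (hG : ∀ i (s : Finset Y), stat prob (f i) = ∑ j ∈ s, stat prob (g j) →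
      G i (f i) = ∑ j ∈ s, G i (g j))
    (h : IsCoarseGraining prob f g π) : ∑ i, G i (f i) = ∑ j, G (π j) (g j) := by
  classical
  rw [← Finset.sum_fiberwise_of_maps_to (g := π) (t := Finset.univ) (fun _ _ => Finset.mem_univ _)]
  refine Finset.sum_congr rfl fun i _ => ?_
  rw [hG i _ (h.2 i)]
  refine Finset.sum_congr (by ext; simp) fun j hj => ?_
  rw [(Finset.mem_filter.mp hj).2]

/-- The scalar `s`, acting on the system `A`. -/
def scal (s : 𝟙_ C ⟶ 𝟙_ C) (A : C) : A ⟶ A := (λ_ A).inv ≫ s ▷ A ≫ (λ_ A).hom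

theorem comp_scal (s : 𝟙_ C ⟶ 𝟙_ C) {A : C} (ω : 𝟙_ C ⟶ A) : ω ≫ scal s A = s ≫ ω := by
  have h : ω ≫ (λ_ A).inv = (λ_ (𝟙_ C)).inv ≫ 𝟙_ C ◁ ω := by simp
  have h2 : (λ_ (𝟙_ C)).inv ≫ s ▷ 𝟙_ C ≫ (λ_ (𝟙_ C)).hom = s := by
    simp [unitors_equal, unitors_inv_equal]
  rw [scal, reassoc_of% h, whisker_exchange_assoc, leftUnitor_naturality,
    reassoc_of% h2]

theorem scal_whiskerRight (s : 𝟙_ C ⟶ 𝟙_ C) (A B : C) : scal s A ▷ B = scal s (A ⊗ B) := by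
  simp [scal, comp_whiskerRight]

theorem state_context {R A : C} (i : 𝟙_ C ⟶ 𝟙_ C ⊗ R) (ω : 𝟙_ C ⟶ A) :
    i ≫ ω ▷ R = ω ≫ (ρ_ A).inv ≫ A ◁ (i ≫ (λ_ R).hom) := by
  rw [rightUnitor_inv_naturality_assoc, ← whisker_exchange]
  have : i = (ρ_ (𝟙_ C)).inv ≫ 𝟙_ C ◁ (i ≫ (λ_ R).hom) := by
    rw [← unitors_inv_equal, ← leftUnitor_inv_naturality]; simp
  conv_lhs => rw [this]
  simp

end Stat

/-! ### Tests, channels and reversible channels -/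

namespace OPT

variable {C : Type u} [Category.{v} C] [MonoidalCategory C] [SymmetricCategory C] (T : OPT C)

theorem prob_id : T.prob (𝟙 (𝟙_ C)) = 1 := by
  simpa using T.prob_sum _ (T.test_id (𝟙_ C))

/-- The input of a context for a state only prepares the ancilla, so it can be absorbed into the
output effect (`state_context`). -/
theorem ext_state {A : C} {ω ω' : 𝟙_ C ⟶ A} (h : ∀ e : A ⟶ 𝟙_ C, T.prob (ω ≫ e) = T.prob (ω' ≫ e)) :
    ω = ω' := by
  apply T.stat_injective
  funext c
  have := h ((ρ_ A).inv ≫ A ◁ (c.input ≫ (λ_ c.R).hom) ≫ c.output)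
  have e1 := state_context c.input ω
  have e2 := state_context c.input ω'
  rw [stat, stat, reassoc_of% e1, reassoc_of% e2]
  simpa using this

/-- An effect in a circuit, as a context for a state. -/
def effectContext {A : C} (e : A ⟶ 𝟙_ C) : Context (𝟙_ C) A :=
  ⟨𝟙_ C, (ρ_ (𝟙_ C)).inv, (ρ_ A).hom ≫ e⟩

theorem prob_comp_effect {A : C} (ω : 𝟙_ C ⟶ A) (e : A ⟶ 𝟙_ C) :
    T.prob (ω ≫ e) = stat T.prob ω (effectContext e) := by
  simp [stat, effectContext]

theorem prob_eq_sum {A : C} {J : Type*} {s : Finset J} {ω : 𝟙_ C ⟶ A} {κ : J → (𝟙_ C ⟶ A)}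
    (h : stat T.prob ω = ∑ j ∈ s, stat T.prob (κ j)) (e : A ⟶ 𝟙_ C) :
    T.prob (ω ≫ e) = ∑ j ∈ s, T.prob (κ j ≫ e) := by
  simp [prob_comp_effect, h]

theorem prob_eq_smul {A : C} {r : ℝ} {ω κ : 𝟙_ C ⟶ A}
    (h : stat T.prob ω = r • stat T.prob κ) (e : A ⟶ 𝟙_ C) :
    T.prob (ω ≫ e) = r * T.prob (κ ≫ e) := by
  simp [prob_comp_effect, h]

theorem stat_scal (s : 𝟙_ C ⟶ 𝟙_ C) (A : C) :
    stat T.prob (scal s A) = T.prob s • stat T.prob (𝟙 A) := by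
  funext c
  have := comp_scal s c.input
  rw [stat, scal_whiskerRight, reassoc_of% this, T.prob_comp]
  simp [stat]

theorem stat_scal_comp (s : 𝟙_ C ⟶ 𝟙_ C) {A B : C} (f : A ⟶ B) :
    stat T.prob (scal s A ≫ f) = T.prob s • stat T.prob f := by
  simpa using (PullsBack.id.postcomp f).stat_smul (T.stat_scal s A)

theorem stat_scalar_comp (s : 𝟙_ C ⟶ 𝟙_ C) {A : C} (ω : 𝟙_ C ⟶ A) :
    stat T.prob (s ≫ ω) = T.prob s • stat T.prob ω := by
  rw [← comp_scal]
  simpa using (PullsBack.id.precomp ω).stat_smul (T.stat_scal s A)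

theorem stat_scalar (s : 𝟙_ C ⟶ 𝟙_ C) :
    stat T.prob s = T.prob s • stat T.prob (𝟙 (𝟙_ C)) := by
  simpa using T.stat_scalar_comp s (𝟙 _)

variable {T}

theorem isTest_of_isCoarseGraining {A B : C} {X Y : Type} [Fintype X] [Fintype Y]
    {f : X → (A ⟶ B)} {g : Y → (A ⟶ B)} {π : Y → X} (hg : T.IsTest g)
    (h : IsCoarseGraining T.prob f g π) : T.IsTest f := by
  obtain ⟨f', hf', h'⟩ := T.coarse_grain g π hg h.1
  have : f' = f := funext fun i => T.stat_injective _ _ (by rw [h'.2 i, h.2 i])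
  exact this ▸ hf'

theorem IsTest.reindex {A B : C} {X Y : Type} [Fintype X] [Fintype Y] {f : X → (A ⟶ B)}
    (hf : T.IsTest f) (e : Y ≃ X) : T.IsTest (fun j => f (e j)) := by
  classical
  refine isTest_of_isCoarseGraining (π := e.symm) hf ⟨e.symm.surjective, fun i => ?_⟩
  rw [Finset.sum_eq_single (e i)]
  · intro b hb hne
    exact absurd (by rw [← (Finset.mem_filter.mp hb).2]; simp) hne
  · intro h
    simp at h

/-- The channel obtained by joining all outcomes of a test. -/
theorem IsTest.exists_channel {A B : C} {X : Type} [Fintype X] [Nonempty X] {f : X → (A ⟶ B)}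
    (hf : T.IsTest f) : ∃ L : A ⟶ B, T.IsChannel L ∧ stat T.prob L = ∑ i, stat T.prob (f i) := by
  obtain ⟨g, hg, h⟩ := T.coarse_grain f (fun _ => ()) hf (fun _ => ⟨Classical.arbitrary X, rfl⟩)
  refine ⟨g (), hg, ?_⟩
  rw [h.2 ()]
  simp

theorem IsTest.comp_channel {A B D : C} {X : Type} [Fintype X] {f : X → (A ⟶ B)}
    (hf : T.IsTest f) {k : B ⟶ D} (hk : T.IsChannel k) : T.IsTest (fun i => f i ≫ k) :=
  (T.test_comp f _ hf hk).reindex (Equiv.prodPUnit X).symm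

theorem IsChannel.comp_test {A B D : C} {X : Type} [Fintype X] {f : X → (B ⟶ D)} {k : A ⟶ B}
    (hk : T.IsChannel k) (hf : T.IsTest f) : T.IsTest (fun i => k ≫ f i) :=
  (T.test_comp _ f hk hf).reindex (Equiv.punitProd X).symm

theorem IsChannel.comp {A B D : C} {f : A ⟶ B} {g : B ⟶ D} (hf : T.IsChannel f)
    (hg : T.IsChannel g) : T.IsChannel (f ≫ g) :=
  IsTest.comp_channel (T := T) hf hg

theorem isChannel_id (A : C) : T.IsChannel (𝟙 A) := T.test_id A

theorem IsTest.tensor_channel {A B A' B' : C} {X : Type} [Fintype X] {f : X → (A ⟶ B)}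
    (hf : T.IsTest f) {k : A' ⟶ B'} (hk : T.IsChannel k) : T.IsTest (fun i => f i ⊗ₘ k) :=
  (T.test_tensor f _ hf hk).reindex (Equiv.prodPUnit X).symm

theorem IsChannel.tensor_test {A B A' B' : C} {X : Type} [Fintype X] {f : X → (A ⟶ B)}
    {k : A' ⟶ B'} (hk : T.IsChannel k) (hf : T.IsTest f) : T.IsTest (fun i => k ⊗ₘ f i) :=
  (T.test_tensor _ f hk hf).reindex (Equiv.punitProd X).symm

theorem IsTest.whiskerRight {A B : C} {X : Type} [Fintype X] {f : X → (A ⟶ B)}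
    (hf : T.IsTest f) (S : C) : T.IsTest (fun i => f i ▷ S) := by
  simpa using hf.tensor_channel (isChannel_id S)

theorem IsTest.whiskerLeft {A B : C} {X : Type} [Fintype X] {f : X → (A ⟶ B)}
    (hf : T.IsTest f) (S : C) : T.IsTest (fun i => S ◁ f i) := by
  simpa using (isChannel_id S).tensor_test hf

theorem IsChannel.whiskerRight {A B : C} {f : A ⟶ B} (hf : T.IsChannel f) (S : C) :
    T.IsChannel (f ▷ S) := IsTest.whiskerRight (T := T) hf S

theorem IsChannel.whiskerLeft {A B : C} {f : A ⟶ B} (hf : T.IsChannel f) (S : C) :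
    T.IsChannel (S ◁ f) := IsTest.whiskerLeft (T := T) hf S

theorem IsTest.scal {X : Type} [Fintype X] {s : X → (𝟙_ C ⟶ 𝟙_ C)} (hs : T.IsTest s) (A : C) :
    T.IsTest (fun i => scal (s i) A) :=
  IsChannel.comp_test (T := T) (T.test_leftUnitor_inv A)
    ((hs.whiskerRight A).comp_channel (T.test_leftUnitor A))

theorem isReversible_of_inverse {A B : C} {f : A ⟶ B} {g : B ⟶ A} (hf : T.IsChannel f)
    (hg : T.IsChannel g) (h : f ≫ g = 𝟙 A) (h' : g ≫ f = 𝟙 B) : T.IsReversible f :=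
  ⟨hf, g, hg, h, h'⟩

theorem isReversible_id (A : C) : T.IsReversible (𝟙 A) :=
  isReversible_of_inverse (isChannel_id A) (isChannel_id A) (by simp) (by simp)

theorem isReversible_braiding (A B : C) : T.IsReversible (β_ A B).hom :=
  isReversible_of_inverse (T.test_swap A B) (T.test_swap B A) (by simp) (by simp)

theorem isReversible_associator (A B D : C) : T.IsReversible (α_ A B D).hom :=
  isReversible_of_inverse (T.test_associator A B D) (T.test_associator_inv A B D)
    (by simp) (by simp)

theorem isReversible_rightUnitor (A : C) : T.IsReversible (ρ_ A).hom :=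
  isReversible_of_inverse (T.test_rightUnitor A) (T.test_rightUnitor_inv A) (by simp) (by simp)

theorem isReversible_rightUnitor_inv (A : C) : T.IsReversible (ρ_ A).inv :=
  isReversible_of_inverse (T.test_rightUnitor_inv A) (T.test_rightUnitor A) (by simp) (by simp)

theorem isReversible_leftUnitor (A : C) : T.IsReversible (λ_ A).hom :=
  isReversible_of_inverse (T.test_leftUnitor A) (T.test_leftUnitor_inv A) (by simp) (by simp)

theorem isReversible_leftUnitor_inv (A : C) : T.IsReversible (λ_ A).inv :=
  isReversible_of_inverse (T.test_leftUnitor_inv A) (T.test_leftUnitor A) (by simp) (by simp)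

theorem IsReversible.whiskerLeft {A B : C} {f : A ⟶ B} (hf : T.IsReversible f) (S : C) :
    T.IsReversible (S ◁ f) := by
  obtain ⟨hf, g, hg, h, h'⟩ := hf
  exact isReversible_of_inverse (hf.whiskerLeft S) (hg.whiskerLeft S)
    (by rw [← whiskerLeft_comp, h, whiskerLeft_id]) (by rw [← whiskerLeft_comp, h', whiskerLeft_id])

/-- A test on a system that has a state has at least one outcome. -/
theorem IsTest.nonempty_of_state {A B : C} {X : Type} [Fintype X] {f : X → (A ⟶ B)}
    (hf : T.IsTest f) (ω : 𝟙_ C ⟶ A) {e : B ⟶ 𝟙_ C} (he : T.IsChannel e) : Nonempty X := by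
  obtain ⟨Y, _, t, y, ht, rfl⟩ := T.exists_test ω
  have := T.prob_sum _ ((T.test_comp t f ht hf).comp_channel he)
  by_contra h
  rw [not_nonempty_iff] at h
  simp at this

theorem prob_comp_le_one {A : C} {X : Type} [Fintype X] {e : X → (A ⟶ 𝟙_ C)}
    (he : T.IsTest e) (ω : 𝟙_ C ⟶ A) (i : X) : T.prob (ω ≫ e i) ≤ 1 := by
  obtain ⟨Y, _, t, y, ht, rfl⟩ := T.exists_test ω
  rw [← T.prob_sum _ (T.test_comp t e ht he)]
  exact Finset.single_le_sum (f := fun k : Y × X => T.prob (t k.1 ≫ e k.2))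
    (fun _ _ => T.prob_nonneg _) (Finset.mem_univ (y, i))

end OPT

/-! ### Consequences of causality; marginals -/

namespace CausalOPT

open OPT

variable {C : Type u} [Category.{v} C] [MonoidalCategory C] [SymmetricCategory C]
  {T : CausalOPT C}

theorem _root_.Operational.OPT.IsTest.comp_channels {A B D : C} {X : Type} [Fintype X]
    {f : X → (A ⟶ B)} (hf : T.IsTest f)
    {k : X → (B ⟶ D)} (hk : ∀ i, T.IsChannel (k i)) : T.IsTest (fun i => f i ≫ k i) :=
  (T.test_conditional (Y := fun _ => Unit) f (fun i _ => k i) hf hk).reindex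
    (Equiv.sigmaPUnit X).symm

theorem _root_.Operational.OPT.IsTest.tensor_channels {A B A' B' : C} {X : Type} [Fintype X]
    {f : X → (A ⟶ B)} (hf : T.IsTest f)
    {k : X → (A' ⟶ B')} (hk : ∀ i, T.IsChannel (k i)) : T.IsTest (fun i => f i ⊗ₘ k i) := by
  simp only [MonoidalCategory.tensorHom_def]
  exact (hf.whiskerRight A').comp_channels fun i => (hk i).whiskerLeft B

theorem _root_.Operational.OPT.IsChannel.comp_discard {A B : C} {f : A ⟶ B} (hf : T.IsChannel f) :
    f ≫ T.discard B = T.discard A :=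
  T.discard_unique _ _ (hf.comp (T.discard_channel B))

theorem discard_unit : T.discard (𝟙_ C) = 𝟙 (𝟙_ C) :=
  (T.discard_unique _ _ (isChannel_id _)).symm

theorem discard_tensor (A B : C) :
    T.discard (A ⊗ B) = A ◁ T.discard B ≫ (ρ_ A).hom ≫ T.discard A :=
  (T.discard_unique _ _ (((T.discard_channel B).whiskerLeft A).comp
    (IsChannel.comp (T := T.toOPT) (T.test_rightUnitor A) (T.discard_channel A)))).symm

/-- The probabilities of a measurement on a state sum to the probability of the state. -/
theorem sum_prob_comp {A B : C} {X : Type} [Fintype X] {f : X → (A ⟶ B)} (hf : T.IsTest f)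
    (ω : 𝟙_ C ⟶ A) :
    ∑ i, T.prob (ω ≫ f i ≫ T.discard B) = T.prob (ω ≫ T.discard A) := by
  have hf' := hf.comp_channel (T.discard_channel B)
  have := hf'.nonempty_of_state ω (isChannel_id _)
  obtain ⟨L, hL, h⟩ := hf'.exists_channel
  rw [T.discard_unique _ _ hL] at h
  have := T.prob_eq_sum ((PullsBack.id.precomp ω).stat_sum h) (𝟙 _)
  simpa using this.symm

/-- Every effect belongs to a test whose probabilities on a state sum to that of `discard`; being
nonnegative, they vanish when the sum does. This disposes of null states, which cannot be
normalized. -/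
theorem eq_of_prob_discard_eq_zero {A : C} {ω ω' : 𝟙_ C ⟶ A}
    (h : T.prob (ω ≫ T.discard A) = 0) (h' : T.prob (ω' ≫ T.discard A) = 0) : ω = ω' := by
  have key : ∀ κ : 𝟙_ C ⟶ A, T.prob (κ ≫ T.discard A) = 0 → ∀ e : A ⟶ 𝟙_ C,
      T.prob (κ ≫ e) = 0 := by
    intro κ hκ e
    obtain ⟨X, _, t, i, ht, rfl⟩ := T.exists_test e
    have := sum_prob_comp ht κ
    rw [hκ, Finset.sum_eq_zero_iff_of_nonneg (fun _ _ => T.prob_nonneg _)] at this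
    simpa [discard_unit] using this i (Finset.mem_univ _)
  exact T.ext_state fun e => by rw [key ω h, key ω' h']

theorem prob_marginalLeft {A B : C} (ω : 𝟙_ C ⟶ A ⊗ B) :
    T.prob (T.marginalLeft ω ≫ T.discard A) = T.prob (ω ≫ T.discard (A ⊗ B)) := by
  simp [marginalLeft, discard_tensor]

theorem marginalLeft_comp_tensor {A B A' B' : C} (ω : 𝟙_ C ⟶ A ⊗ B) (f : A ⟶ A') {g : B ⟶ B'}
    (hg : T.IsChannel g) : T.marginalLeft (ω ≫ (f ⊗ₘ g)) = T.marginalLeft ω ≫ f := by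
  simp only [marginalLeft, MonoidalCategory.tensorHom_def, Category.assoc]
  rw [← whiskerLeft_comp_assoc, hg.comp_discard, ← whisker_exchange_assoc]
  simp

theorem marginalLeft_comp_whiskerRight {A B A' : C} (ω : 𝟙_ C ⟶ A ⊗ B) (f : A ⟶ A') :
    T.marginalLeft (ω ≫ f ▷ B) = T.marginalLeft ω ≫ f := by
  simpa using marginalLeft_comp_tensor ω f (isChannel_id B)

theorem marginalLeft_comp_whiskerLeft {A B B' : C} (ω : 𝟙_ C ⟶ A ⊗ B) {g : B ⟶ B'}
    (hg : T.IsChannel g) : T.marginalLeft (ω ≫ A ◁ g) = T.marginalLeft ω := by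
  simpa using marginalLeft_comp_tensor ω (𝟙 A) hg

theorem marginalLeft_scalar_comp {A B : C} (s : 𝟙_ C ⟶ 𝟙_ C) (ω : 𝟙_ C ⟶ A ⊗ B) :
    T.marginalLeft (s ≫ ω) = s ≫ T.marginalLeft ω := by
  simp [marginalLeft]

theorem marginalLeft_braiding {A B : C} (ω : 𝟙_ C ⟶ A ⊗ B) :
    T.marginalLeft (ω ≫ (β_ A B).hom) = T.marginalRight ω := by
  rw [marginalLeft, marginalRight, Category.assoc, ← BraidedCategory.braiding_naturality_left_assoc,
    braiding_rightUnitor]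

theorem marginalRight_braiding {A B : C} (ω : 𝟙_ C ⟶ A ⊗ B) :
    T.marginalRight (ω ≫ (β_ A B).hom) = T.marginalLeft ω := by
  rw [marginalLeft, marginalRight, Category.assoc,
    ← BraidedCategory.braiding_naturality_right_assoc, braiding_leftUnitor]

theorem marginalLeft_associator {A B D : C} (ω : 𝟙_ C ⟶ (A ⊗ B) ⊗ D) :
    T.marginalLeft (ω ≫ (α_ A B D).hom) = T.marginalLeft (T.marginalLeft ω) := by
  simp [marginalLeft, discard_tensor]

end CausalOPT

/-! ### Stability of purity -/

namespace OPT

variable {C : Type u} [Category.{v} C] [MonoidalCategory C] [SymmetricCategory C] {T : OPT C}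

theorem IsPure.comp_reversible {A B D : C} {f : A ⟶ B} (hf : T.IsPure f) {k : B ⟶ D}
    (hk : T.IsReversible k) : T.IsPure (f ≫ k) := by
  obtain ⟨-, k', hk', e, e'⟩ := hk
  intro X Y _ _ c d π hc hd h i hi
  obtain ⟨p, h1, h2, h3⟩ := hf X Y _ _ π (hc.comp_channel hk') (hd.comp_channel hk')
    (h.map (PullsBack.id.postcomp k')) i (by simp [hi, e])
  refine ⟨p, h1, h2, fun j hj => ?_⟩
  simpa [e'] using (PullsBack.id.postcomp k).stat_smul (h3 j hj)

theorem IsPure.reversible_comp {A B D : C} {f : A ⟶ B} (hf : T.IsPure f) {k : D ⟶ A}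
    (hk : T.IsReversible k) : T.IsPure (k ≫ f) := by
  obtain ⟨-, k', hk', e, e'⟩ := hk
  intro X Y _ _ c d π hc hd h i hi
  obtain ⟨p, h1, h2, h3⟩ := hf X Y _ _ π (hk'.comp_test hc) (hk'.comp_test hd)
    (h.map (PullsBack.id.precomp k')) i (by simp [hi, reassoc_of% e'])
  refine ⟨p, h1, h2, fun j hj => ?_⟩
  simpa [reassoc_of% e] using (PullsBack.id.precomp k).stat_smul (h3 j hj)

theorem isPure_scalar (s : 𝟙_ C ⟶ 𝟙_ C) : T.IsPure s := by
  classical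
  intro X Y _ _ c d π hc hd h i hi
  have hsum : T.prob s = ∑ j ∈ Finset.univ.filter (fun j => π j = i), T.prob (d j) := by
    have := T.prob_eq_sum (h.2 i) (𝟙 _)
    simp only [hi, Category.comp_id] at this
    convert this
  rcases eq_or_ne (T.prob s) 0 with h0 | h0
  · obtain ⟨j₀, hj₀⟩ := h.1 i
    -- All parts of a null scalar are null, so any distribution on the block works; a point mass
    -- exists because blocks are nonempty.
    refine ⟨fun j => if j = j₀ then 1 else 0, fun j => by positivity, ?_, fun j hj => ?_⟩
    · simp [hj₀]
    · rw [h0, eq_comm, Finset.sum_eq_zero_iff_of_nonneg (fun _ _ => T.prob_nonneg _)] at hsum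
      rw [T.stat_scalar (d j), T.stat_scalar s, h0, hsum j (by simp [hj])]
      simp
  · refine ⟨fun j => T.prob (d j) / T.prob s, fun j => div_nonneg (T.prob_nonneg _)
      (T.prob_nonneg _), ?_, fun j _ => ?_⟩
    · rw [← Finset.sum_div, div_eq_one_iff_eq h0, hsum]
    · rw [T.stat_scalar (d j), T.stat_scalar s, smul_smul, div_mul_cancel₀ _ h0]

end OPT

/-! ### Reduction of LOCC protocols on pure states to one-way protocols -/

namespace CausalOPT

open OPT

variable {C : Type u} [Category.{v} C] [MonoidalCategory C] [SymmetricCategory C]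
  {T : CausalOPT C}

namespace PurityPreservation

theorem comp_whiskerLeft (hPP : T.PurityPreservation)
    {A B B' : C} {Ψ : 𝟙_ C ⟶ A ⊗ B} (hΨ : T.IsPure Ψ) {g : B ⟶ B'}
    (hg : T.IsPure g) : T.IsPure (Ψ ≫ A ◁ g) := by
  have := (hPP Ψ ((ρ_ B).hom ≫ g) hΨ
    (hg.reversible_comp (isReversible_rightUnitor B))).reversible_comp
      (isReversible_rightUnitor_inv (𝟙_ C))
  simpa [rightUnitor_inv_naturality_assoc] using this

theorem comp_whiskerRight (hPP : T.PurityPreservation)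
    {A B A' : C} {Ψ : 𝟙_ C ⟶ A ⊗ B} (hΨ : T.IsPure Ψ) {f : A ⟶ A'}
    (hf : T.IsPure f) : T.IsPure (Ψ ≫ f ▷ B) := by
  have := (comp_whiskerLeft hPP (hΨ.comp_reversible (isReversible_braiding A B))
    hf).comp_reversible (isReversible_braiding B A')
  simpa using this

/-- A scalar is a pure state of the trivial bipartite system, on whose second factor `Ψ` acts as a
pure transformation. -/
theorem scalar_comp (hPP : T.PurityPreservation)
    {A : C} (s : 𝟙_ C ⟶ 𝟙_ C) {Ψ : 𝟙_ C ⟶ A} (hΨ : T.IsPure Ψ) :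
    T.IsPure (s ≫ Ψ) := by
  have := (comp_whiskerLeft hPP ((isPure_scalar (T := T.toOPT) s).comp_reversible
    (isReversible_leftUnitor_inv (𝟙_ C))) hΨ).comp_reversible (isReversible_leftUnitor A)
  simpa using this

theorem comp_tensor_state (hPP : T.PurityPreservation)
    {A B E : C} {Ψ : 𝟙_ C ⟶ A ⊗ B} (hΨ : T.IsPure Ψ) {η : 𝟙_ C ⟶ E}
    (hη : T.IsPure η) : T.IsPure (Ψ ≫ A ◁ ((ρ_ B).inv ≫ B ◁ η)) := by
  have := (comp_whiskerLeft hPP (hΨ.comp_reversible (isReversible_rightUnitor_inv (A ⊗ B)))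
    hη).comp_reversible (isReversible_associator A B E)
  simpa using this

/-- On a pure state, a pure transformation on the second system can be replaced by a transformation
on the first system followed by local channels. -/
theorem exists_transfer (hPP : T.PurityPreservation)
    (hLE : T.LocalExchangeability) {A B : C} {Ψ : 𝟙_ C ⟶ A ⊗ B}
    (hΨ : T.IsPure Ψ) :
    ∃ (c : A ⟶ B) (d : B ⟶ A), T.IsChannel c ∧ T.IsChannel d ∧
      ∀ {B₁ : C} (h : B ⟶ B₁), T.IsPure h → ∃ (c' : B₁ ⟶ A) (d' : A ⟶ B₁),
        T.IsChannel c' ∧ T.IsChannel d' ∧ Ψ ≫ A ◁ h = Ψ ≫ ((c ≫ h ≫ c') ⊗ₘ (d ≫ d')) := by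
  obtain ⟨c, d, hc, hd, hcd⟩ := hLE Ψ hΨ
  refine ⟨c, d, hc, hd, fun {B₁} h hh => ?_⟩
  -- The second exchange is applied to the swapped output state, which is still pure, and returns
  -- the systems to their owners.
  have hp := (comp_whiskerLeft hPP hΨ hh).comp_reversible (isReversible_braiding A B₁)
  obtain ⟨c', d', hc', hd', e⟩ := hLE _ hp
  refine ⟨c', d', hc', hd', ?_⟩
  simp only [Category.assoc, SymmetricCategory.symmetry, Category.comp_id] at e
  rw [← e, BraidedCategory.braiding_naturality_right_assoc, ← reassoc_of% hcd]
  simp [← tensorHom_id]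

end PurityPreservation

variable (T) in
/-- `ω'` can be obtained from `ω` by a protocol with one round of communication: a test on the first
system, followed by a channel on the second system that depends on the outcome. -/
def OneWay {A B A' B' : C} (ω : 𝟙_ C ⟶ A ⊗ B) (ω' : 𝟙_ C ⟶ A' ⊗ B') : Prop :=
  ∃ (X : Type) (_ : Fintype X) (a : X → (A ⟶ A')) (b : X → (B ⟶ B')),
    T.IsTest a ∧ (∀ i, T.IsChannel (b i)) ∧
      stat T.prob ω' = ∑ i, stat T.prob (ω ≫ (a i ⊗ₘ b i))

/-- Induction on the protocol. Each test is refined to a pure one, so the state handed to the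
continuation stays pure; a test of Bob is moved to Alice by `exists_transfer`. The exchange channels
depend on the state, hence the quantification over `Ψ` inside the induction and an equality that
holds on `Ψ` only. -/
theorem LOCC.exists_oneWay (hPP : T.PurityPreservation) (hLE : T.LocalExchangeability)
    {A B A' B' : C} (t : LOCC T A B A' B') :
    ∀ Ψ : 𝟙_ C ⟶ A ⊗ B, T.IsPure Ψ →
      ∃ (X : Type) (_ : Fintype X) (a : X → (A ⟶ A')) (b : X → (B ⟶ B')),
        T.IsTest a ∧ (∀ i, T.IsChannel (b i)) ∧
          ∑ k, stat T.prob (Ψ ≫ (t.onAlice k ⊗ₘ t.onBob k)) =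
            ∑ i, stat T.prob (Ψ ≫ (a i ⊗ₘ b i)) := by
  induction t with
  | done A B =>
    intro Ψ _
    exact ⟨Unit, inferInstance, fun _ => 𝟙 A, fun _ => 𝟙 B, T.test_id A, fun _ => isChannel_id B,
      rfl⟩
  | @alice A A₁ B A' B' X _ f hf next ih =>
    intro Ψ hΨ
    obtain ⟨Y, _, g, π, hg, hcg, hp⟩ := T.pure_decomposition f hf
    choose Z _ a b ha hb hab using fun j =>
      ih (π j) (Ψ ≫ g j ▷ B) (hPP.comp_whiskerRight hΨ (hp j))
    refine ⟨(j : Y) × Z j, inferInstance, fun k => g k.1 ≫ a k.1 k.2, fun k => b k.1 k.2,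
      T.test_conditional g a hg ha, fun k => hb k.1 k.2, ?_⟩
    have e1 : ∑ k, stat T.prob (Ψ ≫ ((alice f hf next).onAlice k ⊗ₘ (alice f hf next).onBob k)) =
        ∑ i, ∑ k, stat T.prob (Ψ ≫ ((f i ≫ (next i).onAlice k) ⊗ₘ (next i).onBob k)) :=
      Fintype.sum_sigma (fun k : (i : X) × (next i).Outcome =>
        stat T.prob (Ψ ≫ ((f k.1 ≫ (next k.1).onAlice k.2) ⊗ₘ (next k.1).onBob k.2)))
    rw [e1, hcg.sum_map (fun i f => ∑ k,
      stat T.prob (Ψ ≫ ((f ≫ (next i).onAlice k) ⊗ₘ (next i).onBob k)))]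
    · rw [Fintype.sum_sigma]
      refine Finset.sum_congr rfl fun j _ => ?_
      simpa [← tensorHom_id] using hab j
    · intro i s h
      rw [Finset.sum_comm]
      exact Finset.sum_congr rfl fun k _ =>
        (((PullsBack.id.postcomp _).tensorRight _).precomp Ψ).stat_sum h
  | @bob A B B₁ A' B' X _ f hf next ih =>
    intro Ψ hΨ
    obtain ⟨Y, _, g, π, hg, hcg, hp⟩ := T.pure_decomposition f hf
    obtain ⟨c, d, hc, hd, hcd⟩ := hPP.exists_transfer hLE hΨ
    choose c' d' hc' hd' e using fun j => hcd (g j) (hp j)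
    choose Z _ a b ha hb hab using fun j =>
      ih (π j) (Ψ ≫ A ◁ g j) (hPP.comp_whiskerLeft hΨ (hp j))
    refine ⟨(j : Y) × Z j, inferInstance, fun k => (c ≫ g k.1 ≫ c' k.1) ≫ a k.1 k.2,
      fun k => (d ≫ d' k.1) ≫ b k.1 k.2,
      T.test_conditional (fun j => c ≫ g j ≫ c' j) a (hc.comp_test (hg.comp_channels hc')) ha,
      fun k => (hd.comp (hd' k.1)).comp (hb k.1 k.2), ?_⟩
    have e1 : ∑ k, stat T.prob (Ψ ≫ ((bob f hf next).onAlice k ⊗ₘ (bob f hf next).onBob k)) =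
        ∑ i, ∑ k, stat T.prob (Ψ ≫ ((next i).onAlice k ⊗ₘ (f i ≫ (next i).onBob k))) :=
      Fintype.sum_sigma (fun k : (i : X) × (next i).Outcome =>
        stat T.prob (Ψ ≫ ((next k.1).onAlice k.2 ⊗ₘ (f k.1 ≫ (next k.1).onBob k.2))))
    rw [e1, hcg.sum_map (fun i f => ∑ k,
      stat T.prob (Ψ ≫ ((next i).onAlice k ⊗ₘ (f ≫ (next i).onBob k))))]
    · rw [Fintype.sum_sigma]
      refine Finset.sum_congr rfl fun j _ => ?_
      have h1 : ∀ k, Ψ ≫ ((next (π j)).onAlice k ⊗ₘ (g j ≫ (next (π j)).onBob k)) =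
          (Ψ ≫ A ◁ g j) ≫ ((next (π j)).onAlice k ⊗ₘ (next (π j)).onBob k) := fun k => by
        simp [← id_tensorHom]
      have h2 : ∀ k, Ψ ≫ (((c ≫ g j ≫ c' j) ≫ a j k) ⊗ₘ ((d ≫ d' j) ≫ b j k)) =
          (Ψ ≫ A ◁ g j) ≫ (a j k ⊗ₘ b j k) := fun k => by
        rw [e j, Category.assoc Ψ, tensorHom_comp_tensorHom]
      simp only [h1, h2]
      exact hab j
    · intro i s h
      rw [Finset.sum_comm]
      exact Finset.sum_congr rfl fun k _ =>
        (((PullsBack.id.postcomp _).tensorLeft _).precomp Ψ).stat_sum h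

theorem MoreEntangled.oneWay (hPP : T.PurityPreservation) (hLE : T.LocalExchangeability)
    {A B A' B' : C} {Ψ : 𝟙_ C ⟶ A ⊗ B} {ω : 𝟙_ C ⟶ A' ⊗ B'} (hΨ : T.IsPure Ψ)
    (h : T.MoreEntangled Ψ ω) : T.OneWay Ψ ω := by
  obtain ⟨L, ⟨t, ht⟩, rfl⟩ := h
  obtain ⟨X, _, a, b, ha, hb, e⟩ := t.exists_oneWay hPP hLE Ψ hΨ
  exact ⟨X, _, a, b, ha, hb, by rw [← e, ← (PullsBack.id.precomp Ψ).stat_sum ht]⟩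

namespace OneWay

variable {A B A' B' : C}

theorem moreEntangled {ω : 𝟙_ C ⟶ A ⊗ B} {ω' : 𝟙_ C ⟶ A' ⊗ B'} (h : T.OneWay ω ω') :
    T.MoreEntangled ω ω' := by
  obtain ⟨X, _, a, b, ha, hb, e⟩ := h
  have hab := ha.tensor_channels hb
  have := hab.nonempty_of_state ω (T.discard_channel _)
  obtain ⟨L, -, hL⟩ := hab.exists_channel
  refine ⟨L, ⟨.alice a ha fun i => .bob (fun _ : Unit => b i) (hb i) fun _ => .done A' B', ?_⟩, ?_⟩
  · rw [hL]
    symm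
    refine (Fintype.sum_sigma (fun k : (_ : X) × (_ : Unit) × Unit =>
      stat T.prob ((a k.1 ≫ 𝟙 _) ⊗ₘ (b k.1 ≫ 𝟙 _)))).trans ?_
    refine Finset.sum_congr rfl fun i _ => ?_
    rw [Fintype.sum_sigma]
    simp
  · apply T.stat_injective
    rw [e, (PullsBack.id.precomp ω).stat_sum hL]

/-- Reverses the direction of communication: after the swap the test sits on the second system, and
`exists_transfer` moves its pure refinement back to the first. The outcome-dependent channels `b`
then act on the tested side and are absorbed into the test. -/
theorem braiding (hPP : T.PurityPreservation) (hLE : T.LocalExchangeability)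
    {Ψ : 𝟙_ C ⟶ A ⊗ B} {ω : 𝟙_ C ⟶ A' ⊗ B'} (hΨ : T.IsPure Ψ) (h : T.OneWay Ψ ω) :
    T.OneWay (Ψ ≫ (β_ A B).hom) (ω ≫ (β_ A' B').hom) := by
  obtain ⟨X, _, a, b, ha, hb, e⟩ := h
  obtain ⟨Y, _, g, π, hg, hcg, hp⟩ := T.pure_decomposition a ha
  obtain ⟨c, d, hc, hd, hcd⟩ :=
    hPP.exists_transfer hLE (hΨ.comp_reversible (isReversible_braiding A B))
  choose c' d' hc' hd' e' using fun j => hcd (g j) (hp j)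
  refine ⟨Y, inferInstance, fun j => (c ≫ g j ≫ c' j) ≫ b (π j), fun j => d ≫ d' j,
    (hc.comp_test (hg.comp_channels hc')).comp_channels fun j => hb (π j),
    fun j => hd.comp (hd' j), ?_⟩
  rw [(PullsBack.id.postcomp _).stat_sum e,
    hcg.sum_map (fun i f => stat T.prob ((Ψ ≫ (f ⊗ₘ b i)) ≫ (β_ A' B').hom))
      (fun i s h => (((PullsBack.id.tensorRight _).precomp Ψ).postcomp _).stat_sum h)]
  refine Finset.sum_congr rfl fun j _ => ?_
  have h1 : (Ψ ≫ (g j ⊗ₘ b (π j))) ≫ (β_ A' B').hom =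
      ((Ψ ≫ (β_ A B).hom) ≫ B ◁ g j) ≫ b (π j) ▷ A' := by
    rw [Category.assoc, BraidedCategory.braiding_naturality, Category.assoc, Category.assoc,
      MonoidalCategory.tensorHom_def']
  rw [h1, e' j, Category.assoc, ← tensorHom_id, tensorHom_comp_tensorHom, Category.comp_id]

end OneWay

end CausalOPT

/-! ### Conditioning of allowed distributions -/

namespace OPT

open Filter Topology

variable {C : Type u} [Category.{v} C] [MonoidalCategory C] [SymmetricCategory C] {T : OPT C}

theorem prob_eq_sum_of_isCoarseGraining {X Y : Type} [Fintype X] [Fintype Y] [DecidableEq X]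
    {f : X → (𝟙_ C ⟶ 𝟙_ C)} {g : Y → (𝟙_ C ⟶ 𝟙_ C)} {π : Y → X}
    (h : IsCoarseGraining T.prob f g π) (i : X) :
    T.prob (f i) = ∑ j, if π j = i then T.prob (g j) else 0 := by
  rw [← Finset.sum_filter]
  have := T.prob_eq_sum (h.2 i) (𝟙 _)
  simp only [Category.comp_id] at this
  rw [this]
  congr

/-- Conditioning the outcome distribution of a scalar test on the event that its first outcome is
`x₀` gives an allowed distribution: repeat the test until the event occurs. -/
theorem IsTest.exists_conditioned {X J : Type} [Fintype X] [Fintype J]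
    {q : X × J → (𝟙_ C ⟶ 𝟙_ C)} (hq : T.IsTest q) (x₀ : X) {s : ℝ} (hs : 0 < s) {p : J → ℝ}
    (hp : ∀ j, T.prob (q (x₀, j)) = s * p j) (hp1 : ∑ j, p j = 1) :
    ∃ τ : J → (𝟙_ C ⟶ 𝟙_ C), T.IsTest τ ∧ ∀ j, T.prob (τ j) = p j := by
  classical
  have hqs : ∑ x, ∑ j, T.prob (q (x, j)) = 1 := by
    rw [← T.prob_sum q hq, Fintype.sum_prod_type]
  have hx₀ : ∑ j, T.prob (q (x₀, j)) = s := by simp_rw [hp, ← Finset.mul_sum, hp1, mul_one]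
  have hrest := Finset.add_sum_erase Finset.univ (fun x => ∑ j, T.prob (q (x, j)))
    (Finset.mem_univ x₀)
  simp only [hqs, hx₀] at hrest
  have hs1 : s ≤ 1 := by
    rw [← hrest]
    exact le_add_of_nonneg_right
      (Finset.sum_nonneg fun _ _ => Finset.sum_nonneg fun _ _ => T.prob_nonneg _)
  have step : ∀ τ : J → (𝟙_ C ⟶ 𝟙_ C), T.IsTest τ →
      ∃ τ' : J → (𝟙_ C ⟶ 𝟙_ C), T.IsTest τ' ∧
        ∀ j, T.prob (τ' j) = s * p j + (1 - s) * T.prob (τ j) := by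
    intro τ hτ
    -- Prepend one trial of `q`: keep its second outcome on success and fall back on `τ` otherwise.
    obtain ⟨τ', hτ', h⟩ := T.coarse_grain (fun k : (X × J) × J => q k.1 ≫ τ k.2)
      (fun k => if k.1.1 = x₀ then k.1.2 else k.2) (T.test_comp q τ hq hτ)
      (fun j => ⟨((x₀, j), j), by simp⟩)
    refine ⟨τ', hτ', fun j => ?_⟩
    have hτ1 := T.prob_sum τ hτ
    rw [prob_eq_sum_of_isCoarseGraining h j]
    simp only [T.prob_comp, Fintype.sum_prod_type]
    rw [← Finset.add_sum_erase Finset.univ _ (Finset.mem_univ x₀)]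
    congr 1
    · simp only [if_true]
      rw [Finset.sum_eq_single j]
      · simp [← Finset.mul_sum, hτ1, hp]
      · intro b _ hb
        simp [hb]
      · simp
    · rw [← hrest, add_sub_cancel_left, Finset.sum_mul]
      refine Finset.sum_congr rfl fun x hx => ?_
      rw [Finset.sum_mul]
      refine Finset.sum_congr rfl fun j' _ => ?_
      simp [Finset.ne_of_mem_erase hx]
  have hJ : ∃ τ : J → (𝟙_ C ⟶ 𝟙_ C), T.IsTest τ := by
    obtain ⟨τ, hτ, -⟩ := T.coarse_grain q Prod.snd hq (fun j => ⟨(x₀, j), rfl⟩)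
    exact ⟨τ, hτ⟩
  obtain ⟨τ₀, hτ₀⟩ := hJ
  -- Each further trial multiplies the deviation from `p` by the failure probability `1 - s < 1`.
  have iter : ∀ n : ℕ, ∃ τ : J → (𝟙_ C ⟶ 𝟙_ C), T.IsTest τ ∧
      ∀ j, T.prob (τ j) = p j + (1 - s) ^ n * (T.prob (τ₀ j) - p j) := by
    intro n
    induction n with
    | zero => exact ⟨τ₀, hτ₀, fun j => by simp⟩
    | succ n ih =>
      obtain ⟨τ, hτ, h⟩ := ih
      obtain ⟨τ', hτ', h'⟩ := step τ hτ
      exact ⟨τ', hτ', fun j => by rw [h', h]; ring⟩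
  choose τ hτ hτp using iter
  have hlim : ∀ j, Tendsto (fun n => T.prob (τ n j)) atTop (𝓝 (p j)) := by
    intro j
    simp only [hτp]
    have := (tendsto_pow_atTop_nhds_zero_of_lt_one (sub_nonneg.2 hs1)
      (sub_lt_self 1 hs)).mul_const (T.prob (τ₀ j) - p j)
    simpa using this.const_add (p j)
  obtain ⟨a, ha, h⟩ := (T.measurements_closed (𝟙_ C) J).mem_of_tendsto
    (f := fun n => fun j (ω : 𝟙_ C ⟶ 𝟙_ C) => T.prob (ω ≫ τ n j)) (b := atTop)
    (x := fun j ω => T.prob ω * p j)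
    (tendsto_pi_nhds.2 fun j => tendsto_pi_nhds.2 fun ω => by
      simp only [T.prob_comp]
      exact (hlim j).const_mul _)
    (Eventually.of_forall fun n => ⟨τ n, hτ n, fun _ _ => rfl⟩)
  refine ⟨a, ha, fun j => ?_⟩
  have := h j (𝟙 _)
  simp only [T.prob_id, one_mul, Category.id_comp] at this
  exact this.symm

end OPT

/-! ### From one-way protocols to random reversible channels -/

namespace CausalOPT

open OPT

variable {C : Type u} [Category.{v} C] [MonoidalCategory C] [SymmetricCategory C]
  {T : CausalOPT C} {A B : C}

theorem MoreMixed.refl (ω : 𝟙_ C ⟶ A) : T.MoreMixed ω ω :=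
  ⟨𝟙 A, ⟨isChannel_id A, Unit, inferInstance, fun _ => 𝟙 _, fun _ => 𝟙 A, T.test_id _,
    fun _ => isReversible_id A, by simp [T.prob_id]⟩, by simp⟩

/-- A decomposition of a pure state that is induced by a test on another state of the same
probability. -/
theorem exists_scalar_test_of_isPure {D : C} {ω : 𝟙_ C ⟶ D} {Ψ : 𝟙_ C ⟶ A} (hΨ : T.IsPure Ψ)
    {J : Type} [Fintype J] {f : J → (D ⟶ A)} (hf : T.IsTest f)
    (h : stat T.prob Ψ = ∑ j, stat T.prob (ω ≫ f j)) (hpos : T.prob (Ψ ≫ T.discard A) ≠ 0) :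
    ∃ τ : J → (𝟙_ C ⟶ 𝟙_ C), T.IsTest τ ∧ ∀ j, ω ≫ f j = τ j ≫ Ψ := by
  classical
  -- States need not be normalized: `ω` is one outcome of a preparation test. Purity of `Ψ` is
  -- applied to the composite test, whose block over `x₀` sums to `Ψ`.
  obtain ⟨X, _, t, x₀, ht, rfl⟩ := T.exists_test ω
  have hJ : Nonempty J := hf.nonempty_of_state (t x₀) (T.discard_channel _)
  have htest := T.test_comp t f ht hf
  obtain ⟨c, hc, hcg⟩ := T.coarse_grain _ Prod.fst htest Prod.fst_surjective
  have hsum : ∀ (g : X × J → ℝ), ∑ k ∈ Finset.univ.filter (fun k : X × J => k.1 = x₀), g k =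
      ∑ j, g (x₀, j) := by
    intro g
    rw [Finset.sum_filter, Fintype.sum_prod_type, Finset.sum_eq_single x₀] <;> simp +contextual
  have hcx : c x₀ = Ψ := by
    apply T.stat_injective
    rw [h, hcg.2 x₀]
    funext e
    simp only [Finset.sum_apply]
    rw [← hsum (fun k => stat T.prob (t k.1 ≫ f k.2) e)]
  obtain ⟨p, hp0, hp1, hp⟩ := hΨ X (X × J) c _ Prod.fst hc htest hcg x₀ hcx
  have hp1' : ∑ j, p (x₀, j) = 1 := by
    rw [← hp1, ← hsum]
  -- The composite test gives outcome `(x₀, j)` with the probability of `Ψ` times `p (x₀, j)`;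
  -- conditioning on `x₀` removes the factor.
  obtain ⟨τ, hτ, hτp⟩ := (htest.comp_channel (T.discard_channel A)).exists_conditioned x₀
    (lt_of_le_of_ne (T.prob_nonneg _) hpos.symm) (p := fun j => p (x₀, j))
    (fun j => by rw [T.prob_eq_smul (hp (x₀, j) rfl), mul_comm]) hp1'
  refine ⟨τ, hτ, fun j => T.stat_injective _ _ ?_⟩
  rw [T.stat_scalar_comp, hτp]
  exact hp (x₀, j) rfl

theorem OneWay.moreMixed (hPur : T.Purification) (hPP : T.PurityPreservation)
    {Ψ Ψ' : 𝟙_ C ⟶ A ⊗ B} (hΨ : T.IsPure Ψ) (hΨ' : T.IsPure Ψ') (h : T.OneWay Ψ Ψ') :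
    T.MoreMixed (T.marginalRight Ψ) (T.marginalRight Ψ') := by
  obtain ⟨X, _, a, b, ha, hb, e⟩ := h
  obtain ⟨J, _, g, π, hg, hcg, hp⟩ := T.pure_decomposition a ha
  have hgb : T.IsTest (fun j => g j ⊗ₘ b (π j)) := hg.tensor_channels fun j => hb (π j)
  have e' : stat T.prob Ψ' = ∑ j, stat T.prob (Ψ ≫ (g j ⊗ₘ b (π j))) := by
    rw [e, hcg.sum_map (fun i f => stat T.prob (Ψ ≫ (f ⊗ₘ b i)))
      (fun i s h => ((PullsBack.id.tensorRight _).precomp Ψ).stat_sum h)]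
  have hdisc : T.prob (Ψ' ≫ T.discard _) = T.prob (Ψ ≫ T.discard _) := by
    rw [T.prob_eq_sum e', ← sum_prob_comp hgb Ψ]
    simp
  -- Both states have the same total probability; if it is zero they coincide.
  rcases eq_or_ne (T.prob (Ψ' ≫ T.discard _)) 0 with h0 | h0
  · rw [eq_of_prob_discard_eq_zero (ω := Ψ) (ω' := Ψ') (hdisc ▸ h0) h0]
    exact MoreMixed.refl _
  obtain ⟨τ, hτ, hτΨ⟩ := exists_scalar_test_of_isPure hΨ' hgb e' h0
  -- Bob's channel does not affect the marginal on `A`, so dropping it leaves a purification of the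
  -- marginal of `τ j ≫ Ψ'`.
  have hU : ∀ j, ∃ U : B ⟶ B, T.IsReversible U ∧ Ψ ≫ g j ▷ B = (τ j ≫ Ψ') ≫ A ◁ U := fun j =>
    hPur.2 _ _ (hPP.scalar_comp _ hΨ') (hPP.comp_whiskerRight hΨ (hp j)) (by
      rw [← hτΨ, marginalLeft_comp_tensor _ _ (hb _), marginalLeft_comp_whiskerRight])
  choose U hU hUe using hU
  have hJ : Nonempty J := hg.nonempty_of_state (T.marginalLeft Ψ) (T.discard_channel _)
  obtain ⟨R, hR, hRs⟩ := ((hτ.scal B).comp_channels fun j => (hU j).1).exists_channel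
  refine ⟨R, ⟨hR, J, inferInstance, τ, U, hτ, hU, by simp only [hRs, stat_scal_comp]⟩, ?_⟩
  apply T.stat_injective
  -- Discarding `A` equals performing `g`, discarding the output and forgetting the outcome, so the
  -- marginal on `B` splits over the branches.
  obtain ⟨G, hG, hGs⟩ := (hg.comp_channel (T.discard_channel A)).exists_channel
  rw [T.discard_unique _ _ hG] at hGs
  change _ = stat T.prob (Ψ ≫ T.discard A ▷ B ≫ (λ_ B).hom)
  rw [(PullsBack.id.precomp _).stat_sum hRs,
    (((PullsBack.id.whiskerRight B).postcomp _).precomp Ψ).stat_sum hGs]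
  refine Finset.sum_congr rfl fun j _ => ?_
  have h1 : Ψ ≫ (g j ≫ T.discard A) ▷ B ≫ (λ_ B).hom = T.marginalRight (Ψ ≫ g j ▷ B) := by
    simp [marginalRight]
  have h2 : T.marginalRight ((τ j ≫ Ψ') ≫ A ◁ U j) = τ j ≫ T.marginalRight Ψ' ≫ U j := by
    simp [marginalRight, whisker_exchange_assoc]
  have h3 := comp_scal (τ j) (T.marginalRight Ψ')
  rw [h1, hUe j, h2, reassoc_of% h3]

/-! ### Comparison of purifications with different purifying systems -/

variable {C : Type u} [Category.{v} C] [MonoidalCategory C] [SymmetricCategory C]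
  {T : CausalOPT C}

theorem exists_pure_preparation {A : C} (ω : 𝟙_ C ⟶ A) :
    ∃ (K : Type) (_ : Fintype K) (η : K → (𝟙_ C ⟶ A)), T.IsTest η ∧ ∀ k, T.IsPure (η k) := by
  obtain ⟨X, _, t, x, ht, rfl⟩ := T.exists_test ω
  obtain ⟨K, _, η, π, hη, -, hp⟩ := T.pure_decomposition t ht
  exact ⟨K, _, η, hη, hp⟩

theorem sum_prob_discard {A : C} {K : Type} [Fintype K] {η : K → (𝟙_ C ⟶ A)} (hη : T.IsTest η) :
    ∑ k, T.prob (η k ≫ T.discard A) = 1 :=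
  T.prob_sum _ (hη.comp_channel (T.discard_channel A))

theorem exists_pure_of_prob_ne_zero {A : C} (ω : 𝟙_ C ⟶ A) :
    ∃ ξ : 𝟙_ C ⟶ A, T.IsPure ξ ∧ T.prob (ξ ≫ T.discard A) ≠ 0 := by
  obtain ⟨K, _, η, hη, hp⟩ := exists_pure_preparation (T := T) ω
  by_contra! h
  have := sum_prob_discard hη
  simp [fun k => h _ (hp k)] at this

theorem marginalLeft_comp_tensor_state {A B E : C} (ω : 𝟙_ C ⟶ A ⊗ B) (η : 𝟙_ C ⟶ E) :
    T.marginalLeft (ω ≫ A ◁ ((ρ_ B).inv ≫ B ◁ η)) = (η ≫ T.discard E) ≫ T.marginalLeft ω := by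
  apply T.stat_injective
  rw [T.stat_scalar_comp]
  have h := (((((PullsBack.id.whiskerLeft B).postcomp ((ρ_ B).hom ≫ T.discard B)).precomp
    (ρ_ B).inv).whiskerLeft A).postcomp (ρ_ A).hom |>.precomp ω).stat_smul
      (T.stat_scalar (η ≫ T.discard E))
  simpa [marginalLeft, discard_tensor] using h

/-- Two purifications of the same state, with possibly different purifying systems, are related by a
channel on the purifying systems. -/
theorem Purification.exists_channel (hPur : T.Purification) (hPP : T.PurityPreservation)
    {A B D : C} {Ψ : 𝟙_ C ⟶ A ⊗ B} {Φ : 𝟙_ C ⟶ A ⊗ D} (hΨ : T.IsPure Ψ) (hΦ : T.IsPure Φ)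
    (h : T.marginalLeft Ψ = T.marginalLeft Φ) :
    ∃ V : B ⟶ D, T.IsChannel V ∧ Φ = Ψ ≫ A ◁ V := by
  obtain ⟨K, _, η, hη, hηp⟩ := exists_pure_preparation (T := T) (T.marginalRight Φ)
  obtain ⟨ξ, hξ, hξ0⟩ := exists_pure_of_prob_ne_zero (T := T) (T.marginalRight Ψ)
  -- Attaching `η k` to `Ψ` and `ξ` to `Φ` gives both the purifying system `B ⊗ D`. Neither attached
  -- state need be normalized, so each side is scaled by the weight of the other's, which equalizes
  -- the marginals.
  have hW : ∀ k, ∃ W : B ⊗ D ⟶ B ⊗ D, T.IsReversible W ∧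
      (η k ≫ T.discard D) ≫ (Φ ≫ A ◁ ((ρ_ D).inv ≫ D ◁ ξ)) ≫ A ◁ (β_ D B).hom =
        ((ξ ≫ T.discard B) ≫ Ψ ≫ A ◁ ((ρ_ B).inv ≫ B ◁ η k)) ≫ A ◁ W := fun k => by
    refine hPur.2 _ _ (hPP.scalar_comp _ (hPP.comp_tensor_state hΨ (hηp k)))
      (hPP.scalar_comp _ ((hPP.comp_tensor_state hΦ hξ).comp_reversible
        ((isReversible_braiding D B).whiskerLeft A))) ?_
    rw [marginalLeft_scalar_comp, marginalLeft_scalar_comp,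
      marginalLeft_comp_whiskerLeft _ (T.test_swap D B), marginalLeft_comp_tensor_state,
      marginalLeft_comp_tensor_state, h]
    apply T.stat_injective
    simp only [T.stat_scalar_comp, smul_smul]
    rw [mul_comm]
  choose W hW hWe using hW
  -- Prepare a random pure `η k`, apply the matching `W k`, discard `B`. Outcome `k` yields `Φ`
  -- times the weight of `η k`, after the nonzero weight of `ξ` cancels, and the weights of the `η
  -- k` sum to one.
  have hV : T.IsTest (fun k => (ρ_ B).inv ≫ B ◁ η k ≫ W k ≫ T.discard B ▷ D ≫ (λ_ D).hom) :=
    IsChannel.comp_test (T := T.toOPT) (T.test_rightUnitor_inv B) (by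
      simpa using ((hη.whiskerLeft B).comp_channels fun k => (hW k).1).comp_channel
        (((T.discard_channel B).whiskerRight D).comp (g := (λ_ D).hom) (T.test_leftUnitor D)))
  have key : ∀ k, stat T.prob
      (Ψ ≫ A ◁ ((ρ_ B).inv ≫ B ◁ η k ≫ W k ≫ T.discard B ▷ D ≫ (λ_ D).hom)) =
        T.prob (η k ≫ T.discard D) • stat T.prob Φ := fun k => by
    have e := congrArg (fun ω => stat T.prob (ω ≫ A ◁ (T.discard B ▷ D ≫ (λ_ D).hom))) (hWe k)
    have h1 := ((((PullsBack.id.whiskerLeft D).precomp (ρ_ D).inv).postcomp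
      (ρ_ D).hom |>.whiskerLeft A).precomp Φ).stat_smul (T.stat_scalar (ξ ≫ T.discard B))
    have h2 : D ◁ ξ ≫ (β_ D B).hom ≫ T.discard B ▷ D ≫ (λ_ D).hom =
        D ◁ (ξ ≫ T.discard B) ≫ (ρ_ D).hom := by
      rw [← BraidedCategory.braiding_naturality_right_assoc, braiding_leftUnitor]
      simp
    simp only [Category.assoc, ← whiskerLeft_comp, h2] at e
    simp only [Category.assoc] at h1
    rw [← Category.assoc, ← Category.assoc ξ, T.stat_scalar_comp, T.stat_scalar_comp, h1] at e
    simp only [whiskerLeft_id, Category.id_comp, Iso.inv_hom_id, Category.comp_id] at e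
    rw [smul_comm] at e
    exact (smul_right_injective _ hξ0 e).symm
  have hK : Nonempty K := hη.nonempty_of_state (𝟙 _) (T.discard_channel D)
  obtain ⟨V, hVc, hVs⟩ := hV.exists_channel
  refine ⟨V, hVc, T.stat_injective _ _ ?_⟩
  rw [((PullsBack.id.whiskerLeft A).precomp Ψ).stat_sum hVs]
  simp only [key]
  rw [← Finset.sum_smul, sum_prob_discard hη, one_smul]

end CausalOPT

/-! ### Approximate discrimination of finitely many states -/

/-- If `a < b`, then running `n` trials of success probability `a` or `b` until all succeed, `m`
times over, discriminates between `a` and `b` arbitrarily well. -/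
theorem exists_amplification {a b : ℝ} (ha : 0 ≤ a) (hab : a < b) (hb : b ≤ 1) {ε : ℝ}
    (hε : 0 < ε) :
    ∃ n m : ℕ, 1 - (1 - a ^ n) ^ m ≤ ε ∧ (1 - b ^ n) ^ m ≤ ε := by
  have hb0 : 0 < b := ha.trans_lt hab
  have hlim : Filter.Tendsto (fun n : ℕ => (1 / ε) * (a / b) ^ n + a ^ n) Filter.atTop
      (nhds 0) := by
    have h1 := (tendsto_pow_atTop_nhds_zero_of_lt_one (div_nonneg ha hb0.le)
      ((div_lt_one hb0).2 hab)).const_mul (1 / ε)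
    simpa using h1.add (tendsto_pow_atTop_nhds_zero_of_lt_one ha (hab.trans_le hb))
  -- With `m` the ceiling of `1 / (ε * b ^ n)`, the quantity made small bounds `m * a ^ n`, its
  -- summand `a ^ n` paying for the rounding, while `m * b ^ n ≥ 1 / ε`. Bernoulli's inequality and
  -- the exponential bound conclude.
  obtain ⟨n, hn⟩ := (hlim.eventually (gt_mem_nhds hε)).exists
  have hbn : 0 < b ^ n := pow_pos hb0 n
  have han : 0 ≤ a ^ n := pow_nonneg ha n
  have han1 : a ^ n ≤ 1 := pow_le_one₀ ha (hab.le.trans hb)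
  have hbn1 : b ^ n ≤ 1 := pow_le_one₀ hb0.le hb
  refine ⟨n, ⌈(1 / ε) / b ^ n⌉₊, ?_, ?_⟩
  · have h1 := one_add_mul_le_pow (a := -(a ^ n)) (by linarith) ⌈(1 / ε) / b ^ n⌉₊
    have h2 := mul_le_mul_of_nonneg_right
      (Nat.ceil_lt_add_one (div_nonneg (one_div_pos.2 hε).le hbn.le)).le han
    have h3 : (1 / ε / b ^ n + 1) * a ^ n = (1 / ε) * (a / b) ^ n + a ^ n := by
      rw [div_pow]; field_simp
    rw [h3] at h2
    rw [← sub_eq_add_neg] at h1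
    linarith
  · have h1 : (1 - b ^ n) ^ ⌈(1 / ε) / b ^ n⌉₊ ≤ Real.exp (-(b ^ n)) ^ ⌈(1 / ε) / b ^ n⌉₊ :=
      pow_le_pow_left₀ (by linarith) (by linarith [Real.add_one_le_exp (-(b ^ n))]) _
    have h2 : 1 / ε ≤ ⌈(1 / ε) / b ^ n⌉₊ * b ^ n := (div_le_iff₀ hbn).1 (Nat.le_ceil _)
    rw [← Real.exp_nat_mul] at h1
    have h3 : Real.exp (⌈(1 / ε) / b ^ n⌉₊ * -(b ^ n)) ≤ Real.exp (-(1 / ε)) :=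
      Real.exp_le_exp.2 (by linarith)
    have h4 : Real.exp (-(1 / ε)) ≤ ε := by
      rw [Real.exp_neg]
      refine inv_le_of_inv_le₀ hε ?_
      rw [← one_div]
      linarith [Real.add_one_le_exp (1 / ε)]
    linarith

namespace CausalOPT

open OPT

variable {C : Type u} [Category.{v} C] [MonoidalCategory C] [SymmetricCategory C]
  {T : CausalOPT C}

theorem prob_tensor {A B : C} (ω : 𝟙_ C ⟶ A) (κ : 𝟙_ C ⟶ B) (e : A ⟶ 𝟙_ C) (f : B ⟶ 𝟙_ C) :
    T.prob (((λ_ (𝟙_ C)).inv ≫ (ω ⊗ₘ κ)) ≫ (e ⊗ₘ f) ≫ (λ_ (𝟙_ C)).hom) =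
      T.prob (ω ≫ e) * T.prob (κ ≫ f) := by
  rw [← T.prob_comp]
  congr 1
  rw [Category.assoc, tensorHom_comp_tensorHom_assoc, MonoidalCategory.tensorHom_def,
    Category.assoc, leftUnitor_naturality]
  have := comp_scal (ω ≫ e) (𝟙 (𝟙_ C))
  simp only [scal, Category.id_comp, Category.comp_id] at this
  rw [reassoc_of% this]
  simp

theorem sum_prob_channel {A : C} {ψ : 𝟙_ C ⟶ A} (hψ : T.IsChannel ψ) {Y : Type} [Fintype Y]
    {e : Y → (A ⟶ 𝟙_ C)} (he : T.IsTest e) : ∑ y, T.prob (ψ ≫ e y) = 1 :=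
  T.prob_sum _ (hψ.comp_test he)

variable (T) in
/-- There are a family of normalized states and a measurement that accepts the state with index `x`
with probability `q x`. -/
def Accepts {X : Type} (q : X → ℝ) : Prop :=
  ∃ (E : C) (ψ : X → (𝟙_ C ⟶ E)) (Y : Type) (_ : Fintype Y) (e : Y → (E ⟶ 𝟙_ C)) (S : Finset Y),
    (∀ x, T.IsChannel (ψ x)) ∧ T.IsTest e ∧ ∀ x, ∑ y ∈ S, T.prob (ψ x ≫ e y) = q x

namespace Accepts

variable {X : Type} {q r : X → ℝ}

theorem comp (h : T.Accepts q) {Z : Type} (g : Z → X) : T.Accepts (fun z => q (g z)) := by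
  obtain ⟨E, ψ, Y, _, e, S, hψ, he, hq⟩ := h
  exact ⟨E, fun z => ψ (g z), Y, _, e, S, fun z => hψ _, he, fun z => hq _⟩

theorem one_sub (h : T.Accepts q) : T.Accepts (fun x => 1 - q x) := by
  classical
  obtain ⟨E, ψ, Y, _, e, S, hψ, he, hq⟩ := h
  refine ⟨E, ψ, Y, _, e, Sᶜ, hψ, he, fun x => ?_⟩
  beta_reduce
  rw [← hq, ← sum_prob_channel (hψ x) he, ← Finset.sum_compl_add_sum S, add_sub_cancel_right]

theorem one : T.Accepts (fun _ : X => 1) :=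
  ⟨𝟙_ C, fun _ => 𝟙 _, Unit, inferInstance, fun _ => 𝟙 _, Finset.univ, fun _ => isChannel_id _,
    isChannel_id _, fun _ => by simp [T.prob_id]⟩

theorem mul (hq : T.Accepts q) (hr : T.Accepts r) : T.Accepts (fun x => q x * r x) := by
  obtain ⟨E, ψ, Y, _, e, S, hψ, he, hq⟩ := hq
  obtain ⟨E', ψ', Y', _, e', S', hψ', he', hr⟩ := hr
  refine ⟨E ⊗ E', fun x => (λ_ (𝟙_ C)).inv ≫ (ψ x ⊗ₘ ψ' x), Y × Y', inferInstance,
    fun y => (e y.1 ⊗ₘ e' y.2) ≫ (λ_ (𝟙_ C)).hom, S ×ˢ S',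
    fun x => IsChannel.comp (T := T.toOPT) (T.test_leftUnitor_inv _)
      (IsTest.tensor_channel (T := T.toOPT) (hψ x) (hψ' x)),
    (T.test_tensor e e' he he').comp_channel (T.test_leftUnitor _), fun x => ?_⟩
  beta_reduce
  rw [Finset.sum_product, ← hq, ← hr, Finset.sum_mul_sum]
  simp only [prob_tensor]

theorem pow (hq : T.Accepts q) (n : ℕ) : T.Accepts (fun x => q x ^ n) := by
  induction n with
  | zero => simpa using one
  | succ n ih => simpa [pow_succ] using ih.mul hq

theorem nonneg (hq : T.Accepts q) (x : X) : 0 ≤ q x := by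
  obtain ⟨E, ψ, Y, _, e, S, hψ, he, hq⟩ := hq
  rw [← hq]
  exact Finset.sum_nonneg fun _ _ => T.prob_nonneg _

theorem le_one (hq : T.Accepts q) (x : X) : q x ≤ 1 := sub_nonneg.1 (hq.one_sub.nonneg x)

theorem amplify {q : Bool → ℝ} (hq : T.Accepts q) (h : q false < q true) {ε : ℝ} (hε : 0 < ε) :
    ∃ r : Bool → ℝ, T.Accepts r ∧ r false ≤ ε ∧ 1 - ε ≤ r true := by
  obtain ⟨n, m, h1, h2⟩ := exists_amplification (hq.nonneg false) h (hq.le_one true) hε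
  exact ⟨fun x => 1 - (1 - q x ^ n) ^ m, ((hq.pow n).one_sub.pow m).one_sub, h1, by linarith⟩

end Accepts

/-- Every state becomes normalized by adding a multiple of a given normalized state. -/
theorem exists_normalized {E : C} (ω κ : 𝟙_ C ⟶ E) (hκ : T.IsChannel κ) :
    ∃ φ : 𝟙_ C ⟶ E, T.IsChannel φ ∧ ∀ e : E ⟶ 𝟙_ C,
      T.prob (φ ≫ e) = T.prob (ω ≫ e) + (1 - T.prob (ω ≫ T.discard E)) * T.prob (κ ≫ e) := by
  classical
  obtain ⟨X, _, t, x₀, ht, rfl⟩ := T.exists_test ω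
  have : Nonempty X := ⟨x₀⟩
  -- Run the preparation test of `ω`, and replace the output by `κ` whenever the outcome is not that
  -- of `ω`.
  obtain ⟨φ, hφ, hφs⟩ := (ht.comp_channels
    (k := fun x => if x = x₀ then 𝟙 E else T.discard E ≫ κ) (fun x => by
      split_ifs
      · exact isChannel_id E
      · exact (T.discard_channel E).comp hκ)).exists_channel
  refine ⟨φ, hφ, fun e => ?_⟩
  rw [T.prob_eq_sum hφs, ← sum_prob_discard ht,
    ← Finset.add_sum_erase _ _ (Finset.mem_univ x₀),
    ← Finset.add_sum_erase _ (fun x => T.prob (t x ≫ T.discard E)) (Finset.mem_univ x₀),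
    add_sub_cancel_left, Finset.sum_mul]
  congr 1
  · simp
  · refine Finset.sum_congr rfl fun x hx => ?_
    rw [if_neg (Finset.ne_of_mem_erase hx), ← T.prob_comp]
    simp

/-- Normalizing both states with the same `κ` adds the same term to both, since they have equal
weight; an effect separating them still does. -/
theorem exists_accepts_of_ne {E : C} {ω ω' : 𝟙_ C ⟶ E} (hne : ω ≠ ω')
    (h : T.prob (ω ≫ T.discard E) = T.prob (ω' ≫ T.discard E)) :
    ∃ q : Bool → ℝ, T.Accepts q ∧ q false < q true := by
  obtain ⟨e, he⟩ : ∃ e : E ⟶ 𝟙_ C, T.prob (ω ≫ e) ≠ T.prob (ω' ≫ e) := by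
    by_contra! h
    exact hne (T.ext_state h)
  obtain ⟨X, _, t, x, ht, -⟩ := T.exists_test ω
  have : Nonempty X := ⟨x⟩
  obtain ⟨κ, hκ, -⟩ := ht.exists_channel
  obtain ⟨φ, hφ, hφe⟩ := exists_normalized ω κ hκ
  obtain ⟨φ', hφ', hφe'⟩ := exists_normalized ω' κ hκ
  obtain ⟨Y, _, m, y, hm, rfl⟩ := T.exists_test e
  have hq : T.Accepts (fun b : Bool => T.prob ((if b then φ else φ') ≫ m y)) :=
    ⟨E, fun b => if b then φ else φ', Y, _, m, {y},
      fun b => by cases b <;> simpa, hm, fun b => by simp⟩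
  rcases he.lt_or_gt with hlt | hlt
  · exact ⟨_, hq.comp not, by simp [hφe, hφe', h, hlt]⟩
  · exact ⟨_, hq, by simp [hφe, hφe', h, hlt]⟩

variable (T) in
/-- There are normalized states indexed by `X` that a measurement tells apart with an error
probability of at most `ε`. -/
def Discriminates (X : Type) [Fintype X] (ε : ℝ) : Prop :=
  ∃ (E : C) (ψ : X → (𝟙_ C ⟶ E)) (e : X → (E ⟶ 𝟙_ C)),
    (∀ i, T.IsChannel (ψ i)) ∧ T.IsTest e ∧ ∀ i, 1 - ε ≤ T.prob (ψ i ≫ e i)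

/-- For each index `a` in turn, attach an amplified flag answering whether `i = a`; if the flag
accepts, guess `a`, otherwise use the previous guess. Each extension splits the error budget in
half. -/
theorem discriminates_of_accepts {q : Bool → ℝ} (hq : T.Accepts q) (h : q false < q true)
    (X : Type) [Fintype X] [Nonempty X] {ε : ℝ} (hε : 0 < ε) (hε1 : ε < 1) :
    T.Discriminates X ε := by
  classical
  have key : ∀ (s : Finset X) (ε : ℝ), 0 < ε → ∃ (E : C) (ψ : X → (𝟙_ C ⟶ E)) (Y : Type)
      (_ : Fintype Y) (e : Y → (E ⟶ 𝟙_ C)) (δ : Y → X), (∀ i, T.IsChannel (ψ i)) ∧ T.IsTest e ∧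
        ∀ i ∈ s, 1 - ε ≤ ∑ y, if δ y = i then T.prob (ψ i ≫ e y) else 0 := by
    intro s
    induction s using Finset.induction_on with
    | empty =>
      intro ε _
      exact ⟨𝟙_ C, fun _ => 𝟙 _, Unit, inferInstance, fun _ => 𝟙 _,
        fun _ => Classical.arbitrary X, fun _ => isChannel_id _, isChannel_id _, by simp⟩
    | insert a s has ih =>
      intro ε hε
      obtain ⟨E, ψ, Y, _, e, δ, hψ, he, hδ⟩ := ih (ε / 2) (half_pos hε)
      obtain ⟨r, hr, hr0, hr1⟩ := hq.amplify h (half_pos hε)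
      have hrn := hr.nonneg false
      obtain ⟨E', ψ', Y', _, e', S, hψ', he', hr⟩ := hr
      refine ⟨E' ⊗ E, fun i => (λ_ (𝟙_ C)).inv ≫ (ψ' (decide (i = a)) ⊗ₘ ψ i), Y' × Y,
        inferInstance, fun y => (e' y.1 ⊗ₘ e y.2) ≫ (λ_ (𝟙_ C)).hom,
        fun y => if y.1 ∈ S then a else δ y.2,
        fun x => IsChannel.comp (T := T.toOPT) (T.test_leftUnitor_inv _)
          (IsTest.tensor_channel (T := T.toOPT) (hψ' _) (hψ x)),
        (T.test_tensor e' e he' he).comp_channel (T.test_leftUnitor _), fun i hi => ?_⟩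
      simp only [prob_tensor, Fintype.sum_prod_type]
      rcases eq_or_ne i a with rfl | hia
      · have h1 : 1 - ε / 2 ≤ ∑ y ∈ S, T.prob (ψ' true ≫ e' y) := by rw [hr]; exact hr1
        calc 1 - ε ≤ ∑ y ∈ S, T.prob (ψ' true ≫ e' y) := by linarith
          _ = ∑ y ∈ S, ∑ z, if (if y ∈ S then i else δ z) = i then
                T.prob (ψ' (decide (i = i)) ≫ e' y) * T.prob (ψ i ≫ e z) else 0 := by
              refine Finset.sum_congr rfl fun y hy => ?_
              simp [hy, ← Finset.mul_sum, sum_prob_channel (hψ i) he]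
          _ ≤ _ := Finset.sum_le_univ_sum_of_nonneg fun y => Finset.sum_nonneg fun z _ => by
              split_ifs <;> first
                | exact mul_nonneg (T.prob_nonneg _) (T.prob_nonneg _)
                | exact le_rfl
      · have hi' := hδ i ((Finset.mem_insert.1 hi).resolve_left hia)
        have h1 : 1 - ε / 2 ≤ ∑ y ∈ Sᶜ, T.prob (ψ' false ≫ e' y) := by
          have := Finset.sum_compl_add_sum S (fun y => T.prob (ψ' false ≫ e' y))
          rw [sum_prob_channel (hψ' false) he', hr] at this
          linarith
        have h2 : 1 - ε ≤ (∑ y ∈ Sᶜ, T.prob (ψ' false ≫ e' y)) *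
            ∑ z, if δ z = i then T.prob (ψ i ≫ e z) else 0 := by
          rcases le_total (1 - ε / 2) 0 with h0 | h0
          · exact (show 1 - ε ≤ 0 by linarith).trans (mul_nonneg
              (Finset.sum_nonneg fun _ _ => T.prob_nonneg _)
              (Finset.sum_nonneg fun _ _ => by split_ifs <;> simp [T.prob_nonneg]))
          · refine le_trans ?_ (mul_le_mul h1 hi' h0 (h0.trans h1))
            nlinarith [sq_nonneg ε]
        refine h2.trans ?_
        rw [Finset.sum_mul]
        calc _ = ∑ y ∈ Sᶜ, ∑ z, if (if y ∈ S then a else δ z) = i then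
                T.prob (ψ' (decide (i = a)) ≫ e' y) * T.prob (ψ i ≫ e z) else 0 := by
              refine Finset.sum_congr rfl fun y hy => ?_
              simp [Finset.mem_compl.1 hy, hia, Finset.mul_sum]
          _ ≤ _ := Finset.sum_le_univ_sum_of_nonneg fun y => Finset.sum_nonneg fun z _ => by
              split_ifs <;> first
                | exact mul_nonneg (T.prob_nonneg _) (T.prob_nonneg _)
                | exact le_rfl
  obtain ⟨E, ψ, Y, _, e, δ, hψ, he, hδ⟩ := key Finset.univ ε hε
  -- Success probabilities at least `1 - ε > 0` force every index to be guessed by some outcome, as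
  -- joining outcomes requires.
  have hsurj : Function.Surjective δ := fun i => by
    by_contra! hne
    have := hδ i (Finset.mem_univ i)
    simp [hne] at this
    linarith
  obtain ⟨b, hb, hcg⟩ := T.coarse_grain e δ he hsurj
  refine ⟨E, ψ, b, hψ, hb, fun i => (hδ i (Finset.mem_univ i)).trans (le_of_eq ?_)⟩
  exact (prob_eq_sum_of_isCoarseGraining (hcg.map (PullsBack.id.precomp (ψ i))) i).symm

/-! ### Steering -/

open Filter Topology

theorem prob_comp_tensor_scalar {A : C} (ω : 𝟙_ C ⟶ A) (u : 𝟙_ C ⟶ 𝟙_ C) (a : A ⟶ 𝟙_ C) :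
    T.prob (ω ≫ (ρ_ A).inv ≫ A ◁ u ≫ (ρ_ A).hom ≫ a) = T.prob u * T.prob (ω ≫ a) := by
  have h := ((PullsBack.id.whiskerLeft A).precomp (ω ≫ (ρ_ A).inv)).stat_smul (T.stat_scalar u)
  simpa using T.prob_eq_smul h ((ρ_ A).hom ≫ a)

section Steering

variable {D A B : C} {X : Type} [Fintype X] {Ω : 𝟙_ C ⟶ D} {f : X → (D ⟶ A)} {Ψ : 𝟙_ C ⟶ A ⊗ B}

/-- Approximate steering: if the states indexed by `X` can be told apart up to an error `ε`, then a
decomposition of a marginal of a pure state is approximately induced by a measurement on the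
purifying system. -/
theorem exists_approx_steering (hPur : T.Purification) (hPP : T.PurityPreservation)
    (hf : T.IsTest f) (hΨ : T.IsPure Ψ)
    (h : stat T.prob (T.marginalLeft Ψ) = ∑ i, stat T.prob (Ω ≫ f i)) {ε : ℝ}
    (hD : T.Discriminates X ε) :
    ∃ b : X → (B ⟶ 𝟙_ C), T.IsTest b ∧ ∀ i (a : A ⟶ 𝟙_ C),
      |T.prob (Ψ ≫ A ◁ b i ≫ (ρ_ A).hom ≫ a) - T.prob (Ω ≫ f i ≫ a)| ≤
        ε * ∑ j, T.prob (Ω ≫ f j ≫ a) := by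
  classical
  obtain ⟨E, ψ, e, hψ, he, hε⟩ := hD
  have : Nonempty X := hf.nonempty_of_state Ω (T.discard_channel A)
  -- Record the outcome `i` in the flag `ψ i` and forget it. Discarding the flag restores the
  -- marginal of `Ψ`, so a channel `V` on the purifying system turns `Ψ` into a purification of the
  -- flagged state; the measurement sought reads the flag after `V`.
  have hS : T.IsTest (fun i => f i ≫ (ρ_ A).inv ≫ A ◁ ψ i) := hf.comp_channels fun i =>
    IsChannel.comp (T := T.toOPT) (T.test_rightUnitor_inv A) ((hψ i).whiskerLeft A)
  obtain ⟨S, hSc, hSs⟩ := hS.exists_channel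
  obtain ⟨G, Φ, hΦ, hΦm⟩ := hPur.1 (Ω ≫ S)
  obtain ⟨V, hV, hVe⟩ := hPur.exists_channel hPP hΨ
    (hΦ.comp_reversible (isReversible_associator A E G)) (by
      rw [marginalLeft_associator, hΦm]
      apply T.stat_injective
      rw [h, marginalLeft, ((PullsBack.id.precomp Ω).postcomp
        (A ◁ T.discard E ≫ (ρ_ A).hom)).stat_sum hSs]
      refine Finset.sum_congr rfl fun i _ => ?_
      simp [← whiskerLeft_comp_assoc, (hψ i).comp_discard, discard_unit])
  have hEG : T.IsChannel (E ◁ T.discard G ≫ (ρ_ E).hom) :=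
    IsChannel.comp (T := T.toOPT) ((T.discard_channel G).whiskerLeft E) (T.test_rightUnitor E)
  refine ⟨fun i => (V ≫ E ◁ T.discard G ≫ (ρ_ E).hom) ≫ e i, (hV.comp hEG).comp_test he,
    fun i a => ?_⟩
  have key : T.prob (Ψ ≫ A ◁ ((V ≫ E ◁ T.discard G ≫ (ρ_ E).hom) ≫ e i) ≫ (ρ_ A).hom ≫ a) =
      ∑ j, T.prob (ψ j ≫ e i) * T.prob (Ω ≫ f j ≫ a) := by
    have h1 : Ψ ≫ A ◁ ((V ≫ E ◁ T.discard G ≫ (ρ_ E).hom) ≫ e i) ≫ (ρ_ A).hom ≫ a =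
        (Ω ≫ S) ≫ A ◁ e i ≫ (ρ_ A).hom ≫ a := by
      rw [← hΦm]
      simp only [whiskerLeft_comp, Category.assoc]
      rw [← reassoc_of% hVe]
      simp [marginalLeft]
    rw [h1, T.prob_eq_sum ((PullsBack.id.precomp Ω).stat_sum hSs)]
    refine Finset.sum_congr rfl fun j _ => ?_
    rw [← Category.assoc Ω (f j) a, ← prob_comp_tensor_scalar]
    simp
  -- Off the diagonal, outcomes `i` and `j` on `ψ j` have total probability at most one, and `j`
  -- already has at least `1 - ε`.
  have hdiff : ∀ j, |T.prob (ψ j ≫ e i) - if j = i then 1 else 0| ≤ ε := fun j => by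
    have h1 : T.prob (ψ j ≫ e i) ≤ 1 := prob_comp_le_one he _ i
    have h0 := T.prob_nonneg (ψ j ≫ e i)
    split_ifs with hji
    · subst hji
      rw [abs_sub_comm, abs_of_nonneg (by linarith)]
      linarith [hε j]
    · have h2 := sum_prob_channel (hψ j) he
      have h3 := Finset.sum_le_univ_sum_of_nonneg (s := {j, i})
        (fun k => T.prob_nonneg (ψ j ≫ e k))
      rw [Finset.sum_pair hji, h2] at h3
      rw [sub_zero, abs_of_nonneg h0]
      linarith [hε j]
  have h2 : T.prob (Ω ≫ f i ≫ a) = ∑ j, (if j = i then 1 else 0) * T.prob (Ω ≫ f j ≫ a) := by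
    simp
  rw [key, h2, ← Finset.sum_sub_distrib, Finset.mul_sum]
  refine (Finset.abs_sum_le_sum_abs _ _).trans (Finset.sum_le_sum fun j _ => ?_)
  rw [← sub_mul, abs_mul, abs_of_nonneg (T.prob_nonneg (Ω ≫ f j ≫ a))]
  exact mul_le_mul_of_nonneg_right (hdiff j) (T.prob_nonneg _)

/-- Steering: a decomposition of a marginal of a pure state is induced by a measurement on the
purifying system. -/
theorem exists_steering (hPur : T.Purification) (hPP : T.PurityPreservation)
    (hf : T.IsTest f) (hΨ : T.IsPure Ψ)
    (h : stat T.prob (T.marginalLeft Ψ) = ∑ i, stat T.prob (Ω ≫ f i))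
    (hD : ∀ ε : ℝ, 0 < ε → ε < 1 → T.Discriminates X ε) :
    ∃ b : X → (B ⟶ 𝟙_ C), T.IsTest b ∧ ∀ i, Ψ ≫ A ◁ b i ≫ (ρ_ A).hom = Ω ≫ f i := by
  -- The error is `1 / (n + 2)`; the shift keeps it below one at `n = 0`.
  choose b hb hbe using fun n : ℕ => exists_approx_steering hPur hPP hf hΨ h
    (hD (1 / ((n + 1 : ℕ) + 1 : ℝ)) (by positivity) (by
      rw [div_lt_one (by positivity)]
      push_cast
      linarith [n.cast_nonneg (α := ℝ)]))
  -- There may be too many states for a diagonal subsequence; along an ultrafilter all probabilities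
  -- converge at once, by compactness of the unit interval.
  have hlim : ∀ i (ω : 𝟙_ C ⟶ B), ∃ x : ℝ,
      Tendsto (fun n => T.prob (ω ≫ b n i)) (hyperfilter ℕ : Filter ℕ) (𝓝 x) := fun i ω => by
    obtain ⟨x, -, hx⟩ := (isCompact_Icc (a := (0 : ℝ)) (b := 1)).ultrafilter_le_nhds
      ((hyperfilter ℕ).map fun n => T.prob (ω ≫ b n i))
      (by
        rw [Ultrafilter.coe_map, le_principal_iff, mem_map]
        exact Filter.univ_mem' fun n => ⟨T.prob_nonneg _, prob_comp_le_one (hb n) ω i⟩)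
    exact ⟨x, hx⟩
  choose P hP using hlim
  obtain ⟨c, hc, hcP⟩ := (T.measurements_closed B X).mem_of_tendsto
    (f := fun n => fun i (ω : 𝟙_ C ⟶ B) => T.prob (ω ≫ b n i)) (x := P)
    (b := (hyperfilter ℕ : Filter ℕ))
    (tendsto_pi_nhds.2 fun i => tendsto_pi_nhds.2 fun ω => hP i ω)
    (Eventually.of_forall fun n => ⟨b n, hb n, fun _ _ => rfl⟩)
  refine ⟨c, hc, fun i => T.ext_state fun a => ?_⟩
  -- For a fixed effect `a` on `A`, the joint probability is that of `d` on a state of `B`, where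
  -- the limit is known.
  have hcomm : ∀ d : B ⟶ 𝟙_ C,
      Ψ ≫ A ◁ d ≫ (ρ_ A).hom ≫ a = (Ψ ≫ a ▷ B ≫ (λ_ B).hom) ≫ d := fun d => by
    have : (ρ_ A).hom ≫ a = a ▷ 𝟙_ C ≫ (λ_ (𝟙_ C)).hom := by
      rw [unitors_equal, rightUnitor_naturality]
    rw [this, whisker_exchange_assoc]
    simp
  have h1 : Tendsto (fun n => T.prob (Ψ ≫ A ◁ b n i ≫ (ρ_ A).hom ≫ a)) atTop
      (𝓝 (T.prob (Ω ≫ f i ≫ a))) := by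
    rw [tendsto_iff_dist_tendsto_zero]
    have h0 := (((tendsto_add_atTop_iff_nat 1).2
      (tendsto_one_div_add_atTop_nhds_zero_nat (𝕜 := ℝ))).mul_const
        (∑ j, T.prob (Ω ≫ f j ≫ a)))
    rw [zero_mul] at h0
    exact squeeze_zero (fun _ => dist_nonneg) (fun n => hbe n i a) h0
  simp only [hcomm] at h1
  have h2 := tendsto_nhds_unique (hP i _)
    (h1.mono_left (Nat.hyperfilter_le_atTop))
  simp only [Category.assoc]
  rw [hcomm, ← hcP, h2]

end Steering

/-! ### From random reversible channels to LOCC protocols -/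

theorem MoreMixed.oneWay_braiding (hPur : T.Purification) (hPP : T.PurityPreservation)
    {A B : C} {Ψ Ψ' : 𝟙_ C ⟶ A ⊗ B} (hΨ : T.IsPure Ψ)
    (h : T.MoreMixed (T.marginalLeft Ψ) (T.marginalLeft Ψ')) :
    T.OneWay (Ψ ≫ (β_ A B).hom) (Ψ' ≫ (β_ A B).hom) := by
  obtain ⟨R, ⟨hR, X, _, p, U, hp, hU, hRs⟩, hRe⟩ := h
  -- Distinct states of equal weight supply the flags for steering; if the states coincide, nothing
  -- has to be done.
  rcases eq_or_ne Ψ Ψ' with rfl | hne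
  · exact ⟨Unit, inferInstance, fun _ => 𝟙 _, fun _ => 𝟙 _, T.test_id _, fun _ => isChannel_id _,
      by simp⟩
  have hdisc : T.prob (Ψ ≫ T.discard _) = T.prob (Ψ' ≫ T.discard _) := by
    rw [← prob_marginalLeft, ← prob_marginalLeft, ← hRe, Category.assoc, hR.comp_discard]
  obtain ⟨q, hq, hlt⟩ := exists_accepts_of_ne hne hdisc
  have hX : Nonempty X := hp.nonempty_of_state (𝟙 _) (isChannel_id _)
  have hf : T.IsTest (fun i => (scal (p i) A ≫ U i) ▷ B) :=
    ((hp.scal A).comp_channels fun i => (hU i).1).whiskerRight B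
  have hRs' : stat T.prob R = ∑ i, stat T.prob (scal (p i) A ≫ U i) := by
    simp only [hRs, stat_scal_comp]
  obtain ⟨E, Φ, hΦ, hΦm⟩ := hPur.1 (Ψ' ≫ R ▷ B)
  obtain ⟨b, hb, hbe⟩ := exists_steering hPur hPP hf hΦ
    (by rw [hΦm, ((PullsBack.id.whiskerRight B).precomp Ψ').stat_sum hRs'])
    (fun ε h0 h1 => discriminates_of_accepts hq hlt X h0 h1)
  -- With `B ⊗ E` as purifying system, `Φ` purifies `ρ`, as does `Ψ`, so Bob can create `Φ` alone.
  -- His measurement `b` of `E` then leaves `p i` times `(U i ⊗ 1) Ψ'`, and Alice applies the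
  -- inverse `W i`.
  obtain ⟨V, hV, hVe⟩ := hPur.exists_channel hPP hΨ
    (hΦ.comp_reversible (isReversible_associator A B E)) (by
      rw [marginalLeft_associator, hΦm, marginalLeft_comp_whiskerRight, hRe])
  choose hUc W hW hUW hWU using hU
  refine ⟨X, inferInstance, fun i => V ≫ B ◁ b i ≫ (ρ_ B).hom, W,
    hV.comp_test ((hb.whiskerLeft B).comp_channel (T.test_rightUnitor B)), hW, ?_⟩
  have key : ∀ i, Ψ ≫ A ◁ (V ≫ B ◁ b i ≫ (ρ_ B).hom) = Ψ' ≫ (scal (p i) A ≫ U i) ▷ B :=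
    fun i => by
      rw [← hbe i, whiskerLeft_comp, ← reassoc_of% hVe]
      simp
  have key2 : ∀ i, (Ψ ≫ (β_ A B).hom) ≫ ((V ≫ B ◁ b i ≫ (ρ_ B).hom) ⊗ₘ W i) =
      p i ≫ Ψ' ≫ (β_ A B).hom := fun i => by
    rw [Category.assoc, ← BraidedCategory.braiding_naturality, MonoidalCategory.tensorHom_def',
      Category.assoc, reassoc_of% (key i), ← comp_whiskerRight_assoc, Category.assoc, hUW,
      Category.comp_id, scal_whiskerRight]
    have := comp_scal (p i) Ψ'
    rw [reassoc_of% this]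
  simp only [key2, T.stat_scalar_comp]
  rw [← Finset.sum_smul, T.prob_sum p hp, one_smul]

end CausalOPT

end Operational

theorem theorem2 {C : Type u} [Category.{v} C] [MonoidalCategory C] [SymmetricCategory C]
    (T : Operational.CausalOPT C) (hPur : T.Purification) (hPP : T.PurityPreservation)
    (hLE : T.LocalExchangeability) {A B : C} (Ψ Ψ' : 𝟙_ C ⟶ A ⊗ B)
    (hΨ : T.IsPure Ψ) (hΨ' : T.IsPure Ψ') :
    [T.MoreEntangled Ψ Ψ',
      T.MoreMixed (T.marginalLeft Ψ) (T.marginalLeft Ψ'),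
      T.MoreMixed (T.marginalRight Ψ) (T.marginalRight Ψ')].TFAE := by
  have hβ := hΨ.comp_reversible (Operational.OPT.isReversible_braiding A B)
  have hβ' := hΨ'.comp_reversible (Operational.OPT.isReversible_braiding A B)
  tfae_have 1 → 3 := fun h => (h.oneWay hPP hLE hΨ).moreMixed hPur hPP hΨ hΨ'
  tfae_have 1 → 2 := fun h => by
    simpa only [Operational.CausalOPT.marginalRight_braiding] using
      ((h.oneWay hPP hLE hΨ).braiding hPP hLE hΨ).moreMixed hPur hPP hβ hβ'
  tfae_have 2 → 1 := fun h => by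
    -- The protocol found has Bob measuring; it is reversed to have Alice measuring. In the case of
    -- the marginals on `B` the roles are already exchanged and no reversal is needed.
    have := (Operational.CausalOPT.MoreMixed.oneWay_braiding hPur hPP hΨ h).braiding hPP hLE hβ
    simp only [Category.assoc, SymmetricCategory.symmetry, Category.comp_id] at this
    exact this.moreEntangled
  tfae_have 3 → 1 := fun h => by
    rw [← Operational.CausalOPT.marginalLeft_braiding,
      ← Operational.CausalOPT.marginalLeft_braiding] at h
    have := Operational.CausalOPT.MoreMixed.oneWay_braiding hPur hPP hβ h
    simp only [Category.assoc, SymmetricCategory.symmetry, Category.comp_id] at this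
    exact this.moreEntangled
  tfae_finish
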